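/- **Theorem 2.2.** Let $n\ge 0$. *Setting.* Let $V=\mathbb{C}\text{-span}\{v_0,v_1\}$. Identify $V^{\otimes n}$ with the space of functions $C_2^n=\{0,1\}^n\to\mathbb{C}$, the vector $v_S=v_{i_1}\otimes\cdots\otimes v_{i_n}$ (with $i_r=1$ if $r\in S$ and $i_r=0$ otherwise, $S\subseteq\{1,\dots,n\}$) being the indicator function of the tuple $(i_1,\dots,i_n)$. Put $\pi(x)=\frac{1}{(n+1)\binom{n}{|x|}}$, where $|x|$ is the number of ones of $x$, and $\langle f,g\rangle_\pi=\sum_x f(x)\overline{g(x)}\pi(x)$. The symmetric group $S_n$ acts on $C_2^n$ by permuting coordinates and on $V^{\otimes n}$ by $wv_S=v_{wS}$. Let $K_n$ be the transition operator of the Burnside process, $$(K_nf)(x)=\sum_{y\in C_2^n}K(x,y)f(y),\qquad K(x,y)=\frac{1}{|G_x|}\sum_{s\in G_x\cap G_y}\frac{1}{|\mathfrak{X}_s|},$$ where $G_x\subseteq S_n$ is the stabilizer of $x$ and $\mathfrak{X}_s\subseteq C_2^n$ is the set of fixed points of $s$. Put $\beta_k=\binom{2k}{k}^2/2^{4k}$.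 *Vectors.* Let $M_r=\sum_{i=1}^{r-1}s_{ir}$ for $1\le r\le n$ be the Jucys–Murphy elements ($s_{ir}$ is the transposition of $i$ and $r$, so $M_1=0$), regarded as operators on $V^{\otimes n}$, and let $$\tau_j=s_j+(M_j-M_{j+1})^{-1},\qquad 1\le j\le n-1,$$ where $s_j$ is the transposition of $j$ and $j+1$. For $m\in\{0,\dots,\lfloor n/2\rfloor\}$ and $\ell,i\in\{0,\dots,n-2m\}$ put $$T^{(\ell)}_{m,n}(i)=\sum_{\substack{S\subseteq\{1,\dots,n-2m\}\\|S|=\ell}}(-1)^{m+|S\cap\{1,\dots,i\}|}\binom{2m+\ell}{m+|S\cap\{1,\dots,i\}|},$$ $$g_T^{m,i}=(v_{01}-v_{10})^{\otimes m}\otimes\Big(\sum_{\substack{S\subseteq\{1,\dots,n-2m\}\\|S|=i}}v_S\Big),\qquad f_T^{m,\ell}=\sum_{i=0}^{n-2m}T^{(\ell)}_{m,n}(i)\,g_T^{m,i},$$ where $v_{01}=v_0\otimes v_1$ and $v_{10}=v_1\otimes v_0$, and the subscript $T$ refers to the column reading tableau of shape $(n-m,m)$, whose second row is $2,4,\dots,2m$.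 For a standard Young tableau $Q$ of shape $(n-m,m)$ with second row $a_1<\cdots<a_m$ (so $a_r\ge 2r$), put $$\tau_Q=\tau_Q^{(1)}\cdots\tau_Q^{(m)},\quad \tau_Q^{(r)}=\tau_{a_r-1}\cdots\tau_{2r+1}\tau_{2r},\qquad \gamma_Q=\prod_{r=1}^m\ \prod_{k=2}^{a_r-2r+1}\frac{k^2-1}{k^2},$$ with $\tau_Q^{(r)}=1$ if $a_r=2r$ (empty products are $1$), and let $f_Q^{m,\ell}=\tau_Qf_T^{m,\ell}$. *Claim.* The operators $M_j-M_{j+1}$, $1\le j\le n-1$, are invertible on $V^{\otimes n}$, so that the $\tau_j$ are well defined. The vectors $f_Q^{m,\ell}$, indexed by $m\in\{0,\dots,\lfloor n/2\rfloor\}$, $Q$ a standard tableau of shape $(n-m,m)$ and $\ell\in\{0,\dots,n-2m\}$, form an orthogonal basis of $V^{\otimes n}$ with respect to $\langle\cdot,\cdot\rangle_\pi$. Each $f_Q^{m,\ell}$ is an eigenvector of $K_n$, with eigenvalue $\beta_{(m+\ell)/2}$ if $m+\ell$ is even and $0$ otherwise. Moreover, $$\langle f_Q^{m,\ell},f_Q^{m,\ell}\rangle_\pi=\gamma_Q\,\langle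 f_T^{m,\ell},f_T^{m,\ell}\rangle_\pi=\gamma_Q\,\frac{2^m}{n+1}\sum_{i=0}^{n-2m}\big(T^{(\ell)}_{m,n}(i)\big)^2\,\frac{\binom{n-2m}{i}}{\binom{n}{m+i}}.$$ -/

import Mathlib

namespace BurnsideTableaux

noncomputable section

/-! ### The Burnside process -/

/-- One step of the Burnside process of a finite group `G` acting on a finite set `X`:
from `x` choose `s` uniformly in the stabilizer `G_x`, then choose `y` uniformly among the
fixed points `X_s`.  Thus `K(x, y) = |G_x|⁻¹ * ∑_{s ∈ G_x ∩ G_y} |X_s|⁻¹`. -/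
def burnsideKernel (G X : Type*) [Group G] [Fintype G] [DecidableEq X] [MulAction G X]
    (x y : X) : ℝ :=
  1 / (Nat.card (MulAction.stabilizer G x) : ℝ) *
    ∑ s : G with s • x = x ∧ s • y = y, 1 / (Nat.card (MulAction.fixedBy X s) : ℝ)

/-- The set `C_2^n` of binary `n`-tuples.  Coordinates are numbered by `Fin n`, so the coordinate
with (one-based) number `r` has index `r - 1`. -/
abbrev BinTuple (n : ℕ) : Type := Fin n → Fin 2

/-- `S_n` acts on binary `n`-tuples by permuting the coordinates: `(w • x)_i = x_{w⁻¹ i}`. -/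
instance binTupleAction (n : ℕ) : MulAction (Equiv.Perm (Fin n)) (BinTuple n) where
  smul w x := fun i => x (w⁻¹ i)
  one_smul _ := rfl
  mul_smul _ _ _ := rfl

/-- The number `|x|` of ones of a binary tuple. -/
def weight {n : ℕ} (x : BinTuple n) : ℕ := (Finset.univ.filter fun i => x i = 1).card

/-- The stationary distribution `π(x) = 1 / ((n + 1) * C(n, |x|))`. -/
def stationary {n : ℕ} (x : BinTuple n) : ℝ := 1 / (((n : ℝ) + 1) * (n.choose (weight x) : ℝ))

/-! ### The tensor space as the function space `ℓ²(π)` -/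

/-- The space `V^{⊗ n}`, where `V` has basis `v_0, v_1`, as the space of functions on `C_2^n`:
a function `f` stands for `∑_x f(x) v_{x_1} ⊗ ⋯ ⊗ v_{x_n}`. -/
abbrev TensorSpace (n : ℕ) : Type := BinTuple n → ℂ

/-- The binary tuple with ones exactly at the places in `S`. -/
def tupleOf {n : ℕ} (S : Finset (Fin n)) : BinTuple n := fun i => if i ∈ S then 1 else 0

/-- The basis vector `v_S = v_{i_1} ⊗ ⋯ ⊗ v_{i_n}`, with `i_r = 1` for `r ∈ S` and `i_r = 0`
otherwise. -/
def basisVec {n : ℕ} (S : Finset (Fin n)) : TensorSpace n := Pi.single (tupleOf S) 1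

/-- The inner product `⟨f, g⟩_π = ∑_x f(x) * conj (g(x)) * π(x)`. -/
def innerPi {n : ℕ} (f g : TensorSpace n) : ℂ :=
  ∑ x, f x * (starRingEnd ℂ) (g x) * (stationary x : ℂ)

/-- The transition operator `(K_n f)(x) = ∑_y K(x, y) f(y)` of the Burnside process for `S_n`
acting on `C_2^n`. -/
def transition (n : ℕ) : Module.End ℂ (TensorSpace n) where
  toFun f := fun x => ∑ y, (burnsideKernel (Equiv.Perm (Fin n)) (BinTuple n) x y : ℂ) * f y
  map_add' f g := by
    funext x
    simp [mul_add, Finset.sum_add_distrib]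
  map_smul' c f := by
    funext x
    simp only [Pi.smul_apply, smul_eq_mul, RingHom.id_apply, Finset.mul_sum]
    exact Finset.sum_congr rfl fun y _ => by ring

/-- The number `β_k = C(2k, k)² / 2^{4k}`. -/
def beta (k : ℕ) : ℝ := ((2 * k).choose k : ℝ) ^ 2 / 2 ^ (4 * k)

/-- The operator by which `w ∈ S_n` acts on the tensor space: `(w f)(x) = f(w⁻¹ • x)`, that is,
`w v_S = v_{w S}`. -/
def permOp {n : ℕ} (w : Equiv.Perm (Fin n)) : Module.End ℂ (TensorSpace n) :=
  LinearMap.funLeft ℂ ℂ fun x : BinTuple n => w⁻¹ • x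

lemma permOp_basisVec {n : ℕ} (w : Equiv.Perm (Fin n)) (S : Finset (Fin n)) :
    permOp w (basisVec S) = basisVec (S.map w.toEmbedding) := by
  have h : w • tupleOf S = tupleOf (S.map w.toEmbedding) := by
    funext i
    change (if w⁻¹ i ∈ S then (1 : Fin 2) else 0) = if i ∈ S.map w.toEmbedding then 1 else 0
    congr 1
    simp [Finset.mem_map_equiv]
  funext x
  change (Pi.single (tupleOf S) (1 : ℂ) : TensorSpace n) (w⁻¹ • x) = _
  simp only [basisVec, ← h, Pi.single_apply, inv_smul_eq_iff]

/-! ### Jucys--Murphy elements and intertwiners -/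

/-- The Jucys--Murphy operator `M_r = ∑_{i < r} s_{ir}` (with `M_1 = 0`). -/
def jucysMurphy {n : ℕ} (r : Fin n) : Module.End ℂ (TensorSpace n) :=
  ∑ i ∈ Finset.univ.filter (fun i => i < r), permOp (Equiv.swap i r)

/-- The intertwiner `τ_j = s_j + (M_j - M_{j+1})⁻¹` for `j ∈ {1, …, n - 1}`, where `s_j` exchanges
`j` and `j + 1`.  (The identity for other `j`, which never occurs below.) -/
def tau (n j : ℕ) : Module.End ℂ (TensorSpace n) :=
  if h : 1 ≤ j ∧ j < n then
    permOp (Equiv.swap (⟨j - 1, by omega⟩ : Fin n) ⟨j, h.2⟩) +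
      Ring.inverse
        (jucysMurphy (⟨j - 1, by omega⟩ : Fin n) - jucysMurphy (⟨j, h.2⟩ : Fin n))
  else 1

/-! ### Standard Young tableaux with at most two rows -/

/-- A standard Young tableau of shape `μ` with `n` boxes: a bijective filling of the boxes which
increases along the rows and down the columns.  The filling uses `0, …, n - 1` in place of
`1, …, n`.  The box `(x, y)` lies in row `x` and column `y`, both counted from `0`. -/
structure StdTableau (n : ℕ) (μ : YoungDiagram) where
  entry : μ.cells ≃ Fin n
  row_strict : ∀ c d : μ.cells, c.1.1 = d.1.1 → c.1.2 < d.1.2 → entry c < entry d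
  col_strict : ∀ c d : μ.cells, c.1.2 = d.1.2 → c.1.1 < d.1.1 → entry c < entry d

/-- The Young diagram with rows of lengths `n - m` and `m`, for `2 * m ≤ n`. -/
def twoRow (n m : ℕ) (hm : 2 * m ≤ n) : YoungDiagram :=
  YoungDiagram.ofRowLens [n - m, m] (by
    rw [List.sortedGE_iff_pairwise]
    simp
    omega)

lemma second_mem_twoRow {n m : ℕ} (hm : 2 * m ≤ n) (r : Fin m) :
    ((1, (r : ℕ)) : ℕ × ℕ) ∈ (twoRow n m hm).cells := by
  rw [YoungDiagram.mem_cells, twoRow, YoungDiagram.mem_ofRowLens]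
  exact ⟨by simp, by simp⟩

/-- The entry `a_{r+1} ∈ {1, …, n}` in column `r + 1` of the second row of `Q`, for `0 ≤ r < m`. -/
def secondRow {n m : ℕ} {hm : 2 * m ≤ n} (Q : StdTableau n (twoRow n m hm)) (r : Fin m) : ℕ :=
  (Q.entry ⟨(1, (r : ℕ)), second_mem_twoRow hm r⟩ : ℕ) + 1

/-- The operator `τ_Q = τ_Q^{(1)} ⋯ τ_Q^{(m)}`, where `τ_Q^{(r)} = τ_{a_r - 1} ⋯ τ_{2r+1} τ_{2r}`
(the identity for `a_r = 2r`). -/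
def tauQ {n m : ℕ} {hm : 2 * m ≤ n} (Q : StdTableau n (twoRow n m hm)) :
    Module.End ℂ (TensorSpace n) :=
  (List.ofFn fun r : Fin m =>
    ((List.range' (2 * (r + 1)) (secondRow Q r - 2 * (r + 1))).reverse.map (tau n)).prod).prod

/-- The scalar `γ_Q = γ_Q^{(1)} ⋯ γ_Q^{(m)}`, where `γ_Q^{(r)}` is the product of
`(k² - 1) / k²` over `2 ≤ k ≤ a_r - 2r + 1`. -/
def gammaQ {n m : ℕ} {hm : 2 * m ≤ n} (Q : StdTableau n (twoRow n m hm)) : ℝ :=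
  ∏ r : Fin m, ∏ k ∈ Finset.Icc 2 (secondRow Q r - 2 * (r + 1) + 1),
    ((k : ℝ) ^ 2 - 1) / (k : ℝ) ^ 2

/-! ### The vectors attached to the column reading tableau and to general tableaux -/

/-- The scalar `T^{(ℓ)}_{m,n}(i)`, the sum of
`(-1)^{m + |S ∩ {1,…,i}|} * C(2m + ℓ, m + |S ∩ {1,…,i}|)` over the `ℓ`-element subsets `S` of
`{1, …, n - 2m}`. -/
def scalarT (n m l i : ℕ) : ℝ :=
  ∑ S ∈ (Finset.univ : Finset (Fin (n - 2 * m))).powersetCard l,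
    (-1 : ℝ) ^ (m + (S.filter fun k : Fin (n - 2 * m) => (k : ℕ) < i).card) *
      ((2 * m + l).choose (m + (S.filter fun k : Fin (n - 2 * m) => (k : ℕ) < i).card) : ℝ)

/-- The tensor product `f ⊗ g ∈ V^{⊗ n}` of `f ∈ V^{⊗ a}` and `g ∈ V^{⊗ b}`, for `a + b = n`;
on basis vectors it is concatenation. -/
def tensor {a b n : ℕ} (h : a + b = n) (f : TensorSpace a) (g : TensorSpace b) : TensorSpace n :=
  fun x => f (fun i : Fin a => x (Fin.cast h (Fin.castAdd b i))) *
    g (fun j : Fin b => x (Fin.cast h (Fin.natAdd a j)))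

/-- The tensor power `u^{⊗ m} ∈ V^{⊗ 2m}` of `u ∈ V^{⊗ 2}`. -/
def tensorPow (u : TensorSpace 2) (m : ℕ) : TensorSpace (2 * m) :=
  fun x => ∏ k : Fin m, u ![x ⟨2 * k, by omega⟩, x ⟨2 * k + 1, by omega⟩]

/-- The vector `v_{01} - v_{10}`. -/
def altVec : TensorSpace 2 := basisVec {1} - basisVec {0}

/-- The vector `g_T^{m,i} = (v_{01} - v_{10})^{⊗ m} ⊗ ∑_{|S| = i} v_S` for the column reading
tableau `T` of shape `(n - m, m)`. -/
def gT {n m : ℕ} (hm : 2 * m ≤ n) (i : ℕ) : TensorSpace n :=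
  tensor (Nat.add_sub_of_le hm) (tensorPow altVec m)
    (∑ S ∈ (Finset.univ : Finset (Fin (n - 2 * m))).powersetCard i, basisVec S)

/-- The vector `f_T^{m,ℓ} = ∑_{i=0}^{n-2m} T^{(ℓ)}_{m,n}(i) g_T^{m,i}` for the column reading
tableau `T` of shape `(n - m, m)`. -/
def fT {n m : ℕ} (hm : 2 * m ≤ n) (l : ℕ) : TensorSpace n :=
  ∑ i ∈ Finset.range (n - 2 * m + 1), (scalarT n m l i : ℂ) • gT hm i

/-- The vector `f_Q^{m,ℓ} = τ_Q f_T^{m,ℓ}`. -/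
def fQ {n m : ℕ} {hm : 2 * m ≤ n} (Q : StdTableau n (twoRow n m hm)) (l : ℕ) : TensorSpace n :=
  tauQ Q (fT hm l)

lemma two_mul_le_of_fin {n : ℕ} (m : Fin (n / 2 + 1)) : 2 * (m : ℕ) ≤ n := by omega

/-- The triples `(m, Q, ℓ)` with `m ∈ {0, …, ⌊n/2⌋}`, `Q` a standard tableau of shape `(n - m, m)`
and `ℓ ∈ {0, …, n - 2m}`. -/
abbrev EigIndex (n : ℕ) : Type :=
  Σ m : Fin (n / 2 + 1), StdTableau n (twoRow n m (two_mul_le_of_fin m)) × Fin (n - 2 * m + 1)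

/-- The vector `f_Q^{m,ℓ}` as a function of the triple `(m, Q, ℓ)`. -/
def eigVec {n : ℕ} (a : EigIndex n) : TensorSpace n := fQ a.2.1 (a.2.2 : ℕ)

end

end BurnsideTableaux

open BurnsideTableaux

namespace BurnsideTableaux

noncomputable section

/-! ### Permutation operators and the inner product -/

/-! Eigenvalues. Put φ_z(x) = (-1)^{|z∩x|} C(|z|, |z∩x|) and let B (`signedBinomialOp`) send the
indicator of z to φ_z. Every φ_z is an eigenfunction of K_n with eigenvalue depending only on |z|,
so K_n B = B Λ with Λ multiplication by a function of the weight. The vector g_T^{m,ℓ} is supported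
on weight m+ℓ, and B g_T^{m,ℓ} = f_T^{m,ℓ}: each factor v_01 - v_10 produces one finite difference,
and m differences turn C(m+ℓ, ·) into C(2m+ℓ, m + ·) (`signedBinomialOp_gT`). Since τ_Q is built
from the S_n-action, it commutes with B and Λ; hence f_Q = B τ_Q g_T and K_n f_Q = Λ(m+ℓ) f_Q
(`apply_fQ_of_basic`).

The φ_z are eigenfunctions because K(x,y) factors over the ones and the zeros of x into moments of
the arcsine law (`burnsideKernel_eq`): the sum of 2^{-cycles} over S_k is k! C(2k,k)/4^k.
Coordinates outside z are summed out, leaving a double arcsine average of a signed binomial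
coefficient. This average satisfies the recurrence of the signed binomial coefficient itself, so it
is a multiple of φ_z(x) (`arcsineDoubleSum_eq`). The multiple is an alternating sum, evaluated by
creative telescoping (`arcsineDoubleSum_zero_eq`).

Orthogonality and norms. Jucys-Murphy operators are self-adjoint, f_T has the contents of the column
reading tableau, and τ_j exchanges two adjacent contents. Thus f_Q has the contents of Q, and
different tableaux give orthogonal vectors. On a vector where M_j - M_{j+1} acts by d, the squared
norm is multiplied by 1 - 1/d², which accumulates to γ_Q (`content_tau_prod`). For one Q and
different ℓ, K_n does not suffice, as it vanishes for all odd m+ℓ; instead the self-adjoint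
`separatingOp` has eigenvalue 2n - 2N(N+1) on f_Q, with N = m+ℓ.

Basis. The vectors are nonzero and pairwise orthogonal, hence independent; an injection from a
family of 2^n ballot sets with degrees shows that there are enough of them. -/

lemma permOp_apply {n : ℕ} (w : Equiv.Perm (Fin n)) (f : TensorSpace n) (x : BinTuple n) :
    permOp w f x = f (fun i => x (w i)) := rfl

lemma permOp_mul {n : ℕ} (u w : Equiv.Perm (Fin n)) : permOp (u * w) = permOp u * permOp w := by
  ext f x; rfl

lemma permOp_one {n : ℕ} : permOp (1 : Equiv.Perm (Fin n)) = 1 := by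
  ext f x; rfl

lemma permOp_swap_mul_self {n : ℕ} (a b : Fin n) :
    permOp (Equiv.swap a b) * permOp (Equiv.swap a b) = 1 := by
  rw [← permOp_mul, Equiv.swap_mul_self, permOp_one]

lemma weight_comp {n : ℕ} (w : Equiv.Perm (Fin n)) (x : BinTuple n) :
    weight (fun i => x (w i)) = weight x := by
  unfold weight
  exact Finset.card_bij (fun i _ => w i) (by simp) (by simp)
    (fun b hb => ⟨w.symm b, by simpa using hb, by simp⟩)

lemma weight_le {n : ℕ} (x : BinTuple n) : weight x ≤ n := by
  simpa [weight] using Finset.card_filter_le (Finset.univ : Finset (Fin n)) (fun i => x i = 1)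

lemma stationary_comp {n : ℕ} (w : Equiv.Perm (Fin n)) (x : BinTuple n) :
    stationary (fun i => x (w i)) = stationary x := by
  simp [stationary, weight_comp]

lemma stationary_pos {n : ℕ} (x : BinTuple n) : 0 < stationary x := by
  have := Nat.choose_pos (weight_le x)
  unfold stationary
  positivity

/-- Precomposition with a permutation of the coordinates. -/
def compEquiv {n : ℕ} (w : Equiv.Perm (Fin n)) : BinTuple n ≃ BinTuple n where
  toFun x := fun i => x (w i)
  invFun x := fun i => x (w.symm i)
  left_inv x := by simp
  right_inv x := by simp

lemma innerPi_permOp {n : ℕ} (w : Equiv.Perm (Fin n)) (f g : TensorSpace n) :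
    innerPi (permOp w f) (permOp w g) = innerPi f g := by
  unfold innerPi
  rw [← Equiv.sum_comp (compEquiv w)
    (fun x => f x * (starRingEnd ℂ) (g x) * (stationary x : ℂ))]
  refine Finset.sum_congr rfl fun x _ => ?_
  change _ = _ * _ * ((stationary (fun i => x (w i)) : ℝ) : ℂ)
  rw [stationary_comp]
  rfl

lemma innerPi_add_left {n : ℕ} (f g h : TensorSpace n) :
    innerPi (f + g) h = innerPi f h + innerPi g h := by
  simp [innerPi, add_mul, Finset.sum_add_distrib]

lemma innerPi_add_right {n : ℕ} (f g h : TensorSpace n) :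
    innerPi f (g + h) = innerPi f g + innerPi f h := by
  simp [innerPi, mul_add, add_mul, Finset.sum_add_distrib]

lemma innerPi_smul_left {n : ℕ} (c : ℂ) (f g : TensorSpace n) :
    innerPi (c • f) g = c * innerPi f g := by
  simp [innerPi, Finset.mul_sum, mul_assoc]

lemma innerPi_smul_right {n : ℕ} (c : ℂ) (f g : TensorSpace n) :
    innerPi f (c • g) = (starRingEnd ℂ) c * innerPi f g := by
  simp only [innerPi, Pi.smul_apply, smul_eq_mul, map_mul, Finset.mul_sum]
  exact Finset.sum_congr rfl fun x _ => by ring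

lemma innerPi_zero_left {n : ℕ} (g : TensorSpace n) : innerPi 0 g = 0 := by simp [innerPi]

lemma innerPi_zero_right {n : ℕ} (g : TensorSpace n) : innerPi g 0 = 0 := by simp [innerPi]

lemma eq_zero_of_innerPi_self {n : ℕ} {f : TensorSpace n} (h : innerPi f f = 0) : f = 0 := by
  have h1 : innerPi f f = ((∑ x, Complex.normSq (f x) * stationary x : ℝ) : ℂ) := by
    simp [innerPi, Complex.mul_conj]
  rw [h1, Complex.ofReal_eq_zero, Finset.sum_eq_zero_iff_of_nonneg
    (fun x _ => mul_nonneg (Complex.normSq_nonneg _) (stationary_pos x).le)] at h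
  funext x
  have := h x (Finset.mem_univ x)
  simpa [(stationary_pos x).ne'] using this

/-- Self-adjointness with respect to `⟨·,·⟩_π`. -/
def SelfAdj {n : ℕ} (A : Module.End ℂ (TensorSpace n)) : Prop :=
  ∀ f g, innerPi (A f) g = innerPi f (A g)

lemma SelfAdj.add {n : ℕ} {A B : Module.End ℂ (TensorSpace n)} (hA : SelfAdj A)
    (hB : SelfAdj B) : SelfAdj (A + B) := fun f g => by
  simp [innerPi_add_left, innerPi_add_right, hA f g, hB f g]

lemma SelfAdj.smul {n : ℕ} {A : Module.End ℂ (TensorSpace n)} (hA : SelfAdj A) (c : ℝ) :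
    SelfAdj ((c : ℂ) • A) := fun f g => by
  simp only [LinearMap.smul_apply, innerPi_smul_left, innerPi_smul_right, hA f g,
    Complex.conj_ofReal]

lemma SelfAdj.sub {n : ℕ} {A B : Module.End ℂ (TensorSpace n)} (hA : SelfAdj A)
    (hB : SelfAdj B) : SelfAdj (A - B) := by
  intro f g
  have h := (hA.add (hB.smul (-1))) f g
  simpa [sub_eq_add_neg] using h

lemma selfAdj_zero {n : ℕ} : SelfAdj (0 : Module.End ℂ (TensorSpace n)) := fun f g => by
  simp [innerPi_zero_left, innerPi_zero_right]

lemma SelfAdj.sum {n : ℕ} {ι : Type*} (s : Finset ι) {A : ι → Module.End ℂ (TensorSpace n)}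
    (hA : ∀ i ∈ s, SelfAdj (A i)) : SelfAdj (∑ i ∈ s, A i) :=
  Finset.sum_induction _ _ (fun _ _ => SelfAdj.add) selfAdj_zero hA

lemma selfAdj_swap {n : ℕ} (a b : Fin n) : SelfAdj (permOp (Equiv.swap a b)) := fun f g => by
  have h : permOp (Equiv.swap a b) (permOp (Equiv.swap a b) g) = g := by
    rw [← Module.End.mul_apply, permOp_swap_mul_self, Module.End.one_apply]
  conv_lhs => rw [← h]
  rw [innerPi_permOp]

lemma selfAdj_jucysMurphy {n : ℕ} (r : Fin n) : SelfAdj (jucysMurphy r) :=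
  SelfAdj.sum _ fun _ _ => selfAdj_swap _ _

/-- Eigenvectors of a self-adjoint operator for different real eigenvalues are orthogonal. -/
lemma SelfAdj.orthogonal {n : ℕ} {A : Module.End ℂ (TensorSpace n)} (hA : SelfAdj A)
    {f g : TensorSpace n} {c d : ℝ} (hf : A f = (c : ℂ) • f) (hg : A g = (d : ℂ) • g)
    (hcd : c ≠ d) : innerPi f g = 0 := by
  have h := hA f g
  rw [hf, hg, innerPi_smul_left, innerPi_smul_right, Complex.conj_ofReal] at h
  have h2 : ((c : ℂ) - d) * innerPi f g = 0 := by rw [sub_mul, h, sub_self]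
  rcases mul_eq_zero.1 h2 with h3 | h3
  · exact absurd (by exact_mod_cast sub_eq_zero.1 h3) hcd
  · exact h3

/-! ### Relations between transpositions and Jucys--Murphy elements -/

/-- Conjugation by w carries s_{ik} to s_{w(i)k}, so it only permutes the summands of M_k. -/
lemma permOp_comm_jucysMurphy {n : ℕ} {w : Equiv.Perm (Fin n)} {k : Fin n} (hk : w k = k)
    (hw : ∀ i, w i < k ↔ i < k) : Commute (permOp w) (jucysMurphy k) := by
  unfold Commute SemiconjBy jucysMurphy
  rw [Finset.mul_sum, Finset.sum_mul]
  refine Finset.sum_equiv w (fun i => by simp [hw]) fun i _ => ?_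
  rw [← permOp_mul, ← permOp_mul]
  congr 1
  conv_rhs => rw [← hk]
  exact Equiv.mul_swap_eq_swap_mul w i k

lemma swap_comm_jucysMurphy_of_lt {n : ℕ} {a b k : Fin n} (ha : a < k) (hb : b < k) :
    Commute (permOp (Equiv.swap a b)) (jucysMurphy k) := by
  refine permOp_comm_jucysMurphy (Equiv.swap_apply_of_ne_of_ne ha.ne' hb.ne') fun i => ?_
  rw [Equiv.swap_apply_def]
  split_ifs with h1 h2
  · simp [h1, ha, hb]
  · simp [h2, ha, hb]
  · rfl

lemma swap_comm_jucysMurphy_of_gt {n : ℕ} {a b k : Fin n} (ha : k < a) (hb : k < b) :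
    Commute (permOp (Equiv.swap a b)) (jucysMurphy k) := by
  refine permOp_comm_jucysMurphy (Equiv.swap_apply_of_ne_of_ne ha.ne hb.ne) fun i => ?_
  rw [Equiv.swap_apply_def]
  split_ifs with h1 h2
  · simp [h1, ha.not_gt, hb.not_gt]
  · simp [h2, ha.not_gt, hb.not_gt]
  · rfl

lemma jucysMurphy_comm {n : ℕ} (a b : Fin n) : Commute (jucysMurphy a) (jucysMurphy b) := by
  have key : ∀ a b : Fin n, a < b → Commute (jucysMurphy a) (jucysMurphy b) := by
    intro a b hab
    rw [jucysMurphy]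
    refine Commute.sum_left _ _ _ fun i hi => ?_
    simp only [Finset.mem_filter, Finset.mem_univ, true_and] at hi
    exact swap_comm_jucysMurphy_of_lt (hi.trans hab) hab
  rcases lt_trichotomy a b with h | h | h
  · exact key a b h
  · rw [h]
  · exact (key b a h).symm

/-- The degenerate Hecke relation: M_{j+1} consists of s_j and of the conjugates under s_j of the
summands of M_j. -/
lemma swap_mul_jucysMurphy {n : ℕ} {a b : Fin n} (hab : (a : ℕ) + 1 = b) :
    permOp (Equiv.swap a b) * jucysMurphy a
      = jucysMurphy b * permOp (Equiv.swap a b) - 1 := by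
  have hlt : a < b := by rw [Fin.lt_def]; omega
  have hset : (Finset.univ.filter fun i => i < b)
      = insert a (Finset.univ.filter fun i => i < a) := by
    ext i
    simp only [Finset.mem_filter, Finset.mem_univ, true_and, Finset.mem_insert, Fin.lt_def,
      Fin.ext_iff]
    omega
  have hb : jucysMurphy b = permOp (Equiv.swap a b)
      + ∑ i ∈ Finset.univ.filter (fun i => i < a), permOp (Equiv.swap i b) := by
    rw [jucysMurphy, hset, Finset.sum_insert (by simp)]
  rw [hb, add_mul, permOp_swap_mul_self, add_sub_cancel_left, jucysMurphy, Finset.mul_sum,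
    Finset.sum_mul]
  refine Finset.sum_congr rfl fun i hi => ?_
  simp only [Finset.mem_filter, Finset.mem_univ, true_and] at hi
  rw [← permOp_mul, ← permOp_mul]
  congr 1
  have := Equiv.mul_swap_eq_swap_mul (Equiv.swap a b) i a
  rwa [Equiv.swap_apply_left, Equiv.swap_apply_of_ne_of_ne hi.ne (hi.trans hlt).ne] at this

lemma swap_mul_jucysMurphy_succ {n : ℕ} {a b : Fin n} (hab : (a : ℕ) + 1 = b) :
    permOp (Equiv.swap a b) * jucysMurphy b
      = jucysMurphy a * permOp (Equiv.swap a b) + 1 := by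
  -- Multiplying the previous relation by the involution s_j on both sides interchanges the roles of
  -- M_j and M_{j+1}.
  have h := congrArg (fun A => permOp (Equiv.swap a b) * A * permOp (Equiv.swap a b))
    (swap_mul_jucysMurphy hab)
  simp only [mul_sub, sub_mul, mul_one] at h
  rw [← mul_assoc, permOp_swap_mul_self, one_mul, mul_assoc, mul_assoc, permOp_swap_mul_self,
    mul_one] at h
  rw [h, sub_add_cancel]

/-! ### The intertwiners -/

/-- The difference `M_j - M_{j+1}`. -/
def jmDiff {n : ℕ} (a b : Fin n) : Module.End ℂ (TensorSpace n) :=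
  jucysMurphy a - jucysMurphy b

lemma selfAdj_jmDiff {n : ℕ} (a b : Fin n) : SelfAdj (jmDiff a b) :=
  (selfAdj_jucysMurphy a).sub (selfAdj_jucysMurphy b)

lemma swap_mul_jmDiff {n : ℕ} {a b : Fin n} (hab : (a : ℕ) + 1 = b) :
    permOp (Equiv.swap a b) * jmDiff a b + jmDiff a b * permOp (Equiv.swap a b) + 1 + 1 = 0 := by
  rw [jmDiff, mul_sub, swap_mul_jucysMurphy hab, swap_mul_jucysMurphy_succ hab, sub_mul]
  abel

lemma SelfAdj.ker_sq {n : ℕ} {A : Module.End ℂ (TensorSpace n)} (hA : SelfAdj A)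
    {f : TensorSpace n} (h : A (A f) = 0) : A f = 0 := by
  apply eq_zero_of_innerPi_self
  rw [hA, h, innerPi_zero_right]

/-- Write D for the difference and s for the transposition. If Dv = 0, then sD + Ds = -2 gives D(sv)
= -2v, so D²(sv) = 0. Self-adjointness forces D(sv) = 0, hence v = 0; injectivity suffices in finite
dimension. -/
lemma isUnit_jmDiff {n : ℕ} {a b : Fin n} (hab : (a : ℕ) + 1 = b) : IsUnit (jmDiff a b) := by
  rw [LinearMap.isUnit_iff_ker_eq_bot, LinearMap.ker_eq_bot']
  intro v hv
  have h := congrArg (fun A : Module.End ℂ (TensorSpace n) => A v) (swap_mul_jmDiff hab)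
  simp only [Module.End.mul_apply, hv, map_zero, LinearMap.add_apply, Module.End.one_apply,
    LinearMap.zero_apply, zero_add] at h
  have h3 : jmDiff a b (permOp (Equiv.swap a b) v) = (-2 : ℂ) • v := by
    rw [neg_smul, two_smul]
    linear_combination (exp := 1) h
  have h4 := (selfAdj_jmDiff a b).ker_sq (f := permOp (Equiv.swap a b) v)
    (by rw [h3, map_smul, hv, smul_zero])
  rw [h3] at h4
  simpa using h4

/-- The inverse of `M_j - M_{j+1}`. -/
def jmInv {n : ℕ} (a b : Fin n) : Module.End ℂ (TensorSpace n) := Ring.inverse (jmDiff a b)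

lemma jmDiff_mul_jmInv {n : ℕ} {a b : Fin n} (hab : (a : ℕ) + 1 = b) :
    jmDiff a b * jmInv a b = 1 := Ring.mul_inverse_cancel _ (isUnit_jmDiff hab)

lemma jmInv_mul_jmDiff {n : ℕ} {a b : Fin n} (hab : (a : ℕ) + 1 = b) :
    jmInv a b * jmDiff a b = 1 := Ring.inverse_mul_cancel _ (isUnit_jmDiff hab)

lemma commute_jmInv {n : ℕ} {a b : Fin n} (hab : (a : ℕ) + 1 = b)
    {A : Module.End ℂ (TensorSpace n)} (hA : Commute A (jmDiff a b)) :
    Commute A (jmInv a b) := by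
  unfold Commute SemiconjBy at *
  calc A * jmInv a b = (jmInv a b * jmDiff a b) * A * jmInv a b := by
        rw [jmInv_mul_jmDiff hab, one_mul]
    _ = jmInv a b * (A * jmDiff a b) * jmInv a b := by rw [hA]; simp only [mul_assoc]
    _ = jmInv a b * A * (jmDiff a b * jmInv a b) := by simp only [mul_assoc]
    _ = jmInv a b * A := by rw [jmDiff_mul_jmInv hab, mul_one]

lemma selfAdj_jmInv {n : ℕ} {a b : Fin n} (hab : (a : ℕ) + 1 = b) : SelfAdj (jmInv a b) := by
  intro f g
  have h : ∀ f, jmDiff a b (jmInv a b f) = f := fun f => by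
    rw [← Module.End.mul_apply, jmDiff_mul_jmInv hab, Module.End.one_apply]
  conv_lhs => rw [← h g]
  rw [← selfAdj_jmDiff a b, h]

/-- The intertwiner attached to adjacent coordinates. -/
def intertwiner {n : ℕ} (a b : Fin n) : Module.End ℂ (TensorSpace n) :=
  permOp (Equiv.swap a b) + jmInv a b

lemma tau_eq {n j : ℕ} (h1 : 1 ≤ j) (h2 : j < n) :
    tau n j = intertwiner (⟨j - 1, by omega⟩ : Fin n) ⟨j, h2⟩ := by
  rw [tau, dif_pos ⟨h1, h2⟩]
  rfl

lemma selfAdj_intertwiner {n : ℕ} {a b : Fin n} (hab : (a : ℕ) + 1 = b) :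
    SelfAdj (intertwiner a b) := (selfAdj_swap a b).add (selfAdj_jmInv hab)

lemma commute_jucysMurphy_jmDiff {n : ℕ} (a b k : Fin n) :
    Commute (jucysMurphy k) (jmDiff a b) :=
  (jucysMurphy_comm k a).sub_right (jucysMurphy_comm k b)

/-- The defect 1 in the relation between s and M_b equals (M_a - M_b)(M_a - M_b)⁻¹, which is exactly
what the correction term of the intertwiner absorbs. -/
lemma jucysMurphy_mul_intertwiner {n : ℕ} {a b : Fin n} (hab : (a : ℕ) + 1 = b) :
    jucysMurphy a * intertwiner a b = intertwiner a b * jucysMurphy b := by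
  rw [intertwiner, add_mul, swap_mul_jucysMurphy_succ hab, mul_add,
    ← (commute_jmInv hab (commute_jucysMurphy_jmDiff a b b)).eq, add_assoc]
  congr 1
  rw [← jmDiff_mul_jmInv hab, jmDiff, sub_mul, sub_add_cancel]

lemma jucysMurphy_succ_mul_intertwiner {n : ℕ} {a b : Fin n} (hab : (a : ℕ) + 1 = b) :
    jucysMurphy b * intertwiner a b = intertwiner a b * jucysMurphy a := by
  rw [intertwiner, add_mul, swap_mul_jucysMurphy hab, mul_add,
    ← (commute_jmInv hab (commute_jucysMurphy_jmDiff a b a)).eq]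
  rw [← jmDiff_mul_jmInv hab, jmDiff, sub_mul]
  abel

lemma jucysMurphy_comm_intertwiner {n : ℕ} {a b k : Fin n} (hab : (a : ℕ) + 1 = b)
    (ha : k ≠ a) (hb : k ≠ b) : Commute (jucysMurphy k) (intertwiner a b) := by
  refine Commute.add_right ?_ (commute_jmInv hab (commute_jucysMurphy_jmDiff a b k))
  have : k < a ∨ b < k := by
    simp only [Fin.lt_def, ne_eq, Fin.ext_iff] at *
    omega
  have hlt : a < b := by rw [Fin.lt_def]; omega
  rcases this with h | h
  · exact (swap_comm_jucysMurphy_of_gt h (h.trans hlt)).symm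
  · exact (swap_comm_jucysMurphy_of_lt (hlt.trans h) h).symm

/-- Multiplying sD + Ds + 2 = 0 by D⁻¹ on both sides gives sD⁻¹ + D⁻¹s = -2D⁻², the cross term in (s
+ D⁻¹)². -/
lemma intertwiner_mul_self {n : ℕ} {a b : Fin n} (hab : (a : ℕ) + 1 = b) :
    intertwiner a b * intertwiner a b = 1 - jmInv a b * jmInv a b := by
  have h : permOp (Equiv.swap a b) * jmInv a b + jmInv a b * permOp (Equiv.swap a b)
      + jmInv a b * jmInv a b + jmInv a b * jmInv a b = 0 := by
    have := congrArg (fun A => jmInv a b * A * jmInv a b) (swap_mul_jmDiff hab)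
    simp only [mul_add, add_mul, mul_one, mul_zero, zero_mul] at this
    rw [← mul_assoc (jmInv a b) (permOp _), mul_assoc _ (jmDiff a b), jmDiff_mul_jmInv hab,
      mul_one, ← mul_assoc (jmInv a b) (jmDiff a b), jmInv_mul_jmDiff hab, one_mul] at this
    rw [← this]
    abel
  rw [intertwiner, mul_add, add_mul, add_mul, permOp_swap_mul_self, eq_sub_iff_add_eq]
  conv_rhs => rw [← add_zero (1 : Module.End ℂ (TensorSpace n)), ← h]
  abel

/-- An operator that commutes with the action of `S_n` commutes with the intertwiners. -/
lemma commute_tau {n : ℕ} {A : Module.End ℂ (TensorSpace n)}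
    (hA : ∀ w, Commute A (permOp w)) (j : ℕ) : Commute A (tau n j) := by
  by_cases h : 1 ≤ j ∧ j < n
  · rw [tau_eq h.1 h.2]
    have hJ : ∀ k : Fin n, Commute A (jucysMurphy k) := fun k =>
      Commute.sum_right _ _ _ fun i _ => hA _
    exact (hA _).add_right (commute_jmInv (by simp; omega) ((hJ _).sub_right (hJ _)))
  · rw [tau, dif_neg h]
    exact Commute.one_right A

lemma commute_tauQ {n m : ℕ} {hm : 2 * m ≤ n} {A : Module.End ℂ (TensorSpace n)}
    (hA : ∀ w, Commute A (permOp w)) (Q : StdTableau n (twoRow n m hm)) :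
    Commute A (tauQ Q) := by
  refine Commute.list_prod_right _ _ fun B hB => ?_
  obtain ⟨r, rfl⟩ := (List.mem_ofFn' _ _).1 hB
  refine Commute.list_prod_right _ _ fun C hC => ?_
  obtain ⟨j, -, rfl⟩ := List.mem_map.1 hC
  exact commute_tau hA j

/-! ### Content vectors -/

/-- `f` is a joint eigenvector (or `0`) of the Jucys--Murphy operators, with eigenvalues `c`. -/
def HasContent {n : ℕ} (c : ℕ → ℤ) (f : TensorSpace n) : Prop :=
  ∀ r : Fin n, jucysMurphy r f = (((c r : ℤ) : ℝ) : ℂ) • f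

lemma HasContent.congr {n : ℕ} {c c' : ℕ → ℤ} {f : TensorSpace n} (h : HasContent c f)
    (hc : ∀ r < n, c r = c' r) : HasContent c' f := fun r => by
  rw [h r, hc r r.2]

lemma HasContent.orthogonal {n : ℕ} {c c' : ℕ → ℤ} {f g : TensorSpace n} (hf : HasContent c f)
    (hg : HasContent c' g) {r : ℕ} (hr : r < n) (hne : c r ≠ c' r) : innerPi f g = 0 :=
  (selfAdj_jucysMurphy ⟨r, hr⟩).orthogonal (hf ⟨r, hr⟩) (hg ⟨r, hr⟩) (by exact_mod_cast hne)

lemma HasContent.intertwiner {n : ℕ} {c c' : ℕ → ℤ} {f : TensorSpace n} (hf : HasContent c f)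
    {a b : Fin n} (hab : (a : ℕ) + 1 = b) (ha : c' a = c b) (hb : c' b = c a)
    (hk : ∀ k, k ≠ (a : ℕ) → k ≠ b → c' k = c k) : HasContent c' (intertwiner a b f) := by
  intro r
  by_cases hra : r = a
  · rw [hra, ← Module.End.mul_apply, jucysMurphy_mul_intertwiner hab, Module.End.mul_apply, hf b,
      map_smul, ha]
  by_cases hrb : r = b
  · rw [hrb, ← Module.End.mul_apply, jucysMurphy_succ_mul_intertwiner hab, Module.End.mul_apply,
      hf a, map_smul, hb]
  rw [← Module.End.mul_apply, (jucysMurphy_comm_intertwiner hab hra hrb).eq,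
    Module.End.mul_apply, hf r, map_smul, hk r (by rwa [ne_eq, ← Fin.ext_iff])
      (by rwa [ne_eq, ← Fin.ext_iff])]

/-- The intertwiner is self-adjoint and its square is 1 - D⁻², where D acts on f by the scalar d. -/
lemma HasContent.innerPi_intertwiner {n : ℕ} {c : ℕ → ℤ} {f : TensorSpace n}
    (hf : HasContent c f) {a b : Fin n} (hab : (a : ℕ) + 1 = b) {d : ℝ}
    (hd : ((c a : ℤ) : ℝ) - c b = d) (h0 : d ≠ 0) :
    innerPi (BurnsideTableaux.intertwiner a b f) (BurnsideTableaux.intertwiner a b f)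
      = ((1 - 1 / d ^ 2 : ℝ) : ℂ) * innerPi f f := by
  have hd' : (d : ℂ) ≠ 0 := by exact_mod_cast h0
  have h1 : jmDiff a b f = (d : ℂ) • f := by
    rw [jmDiff, LinearMap.sub_apply, hf a, hf b, ← sub_smul, ← hd]
    push_cast
    rfl
  have h2 : jmInv a b f = (d : ℂ)⁻¹ • f := by
    have : jmInv a b (jmDiff a b f) = f := by
      rw [← Module.End.mul_apply, jmInv_mul_jmDiff hab, Module.End.one_apply]
    rw [h1, map_smul] at this
    rwa [eq_inv_smul_iff₀ hd']
  rw [selfAdj_intertwiner hab, ← Module.End.mul_apply, intertwiner_mul_self hab,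
    LinearMap.sub_apply, Module.End.one_apply, Module.End.mul_apply, h2, map_smul, h2, smul_smul]
  have h3 : f - ((d : ℂ)⁻¹ * (d : ℂ)⁻¹) • f = ((1 - 1 / d ^ 2 : ℝ) : ℂ) • f := by
    rw [Complex.ofReal_sub, sub_smul, Complex.ofReal_one, one_smul]
    congr 2
    push_cast
    field_simp
  rw [h3, innerPi_smul_right, Complex.conj_ofReal]

/-- The number of elements of `R` that are at most `p`. -/
def countLE (R : Finset ℕ) (p : ℕ) : ℕ := (R.filter (· ≤ p)).card

/-- The content of the box holding `p`, in the two-row tableau whose second row is `R`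
(entries counted from `0`). -/
def contentOf (R : Finset ℕ) (p : ℕ) : ℤ :=
  if p ∈ R then (countLE R p : ℤ) - 2 else (p : ℤ) - countLE R p

lemma countLE_succ (R : Finset ℕ) (p : ℕ) :
    countLE R (p + 1) = countLE R p + if p + 1 ∈ R then 1 else 0 := by
  have : R.filter (· ≤ p + 1) = R.filter (· ≤ p) ∪ R.filter (· = p + 1) := by
    ext x
    simp only [Finset.mem_filter, Finset.mem_union]
    constructor
    · rintro ⟨h1, h2⟩
      rcases Nat.lt_or_ge p x with h | h
      · exact Or.inr ⟨h1, by omega⟩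
      · exact Or.inl ⟨h1, h⟩
    · rintro (⟨h1, h2⟩ | ⟨h1, h2⟩)
      · exact ⟨h1, by omega⟩
      · exact ⟨h1, by omega⟩
  rw [countLE, this, Finset.card_union_of_disjoint, countLE, Finset.filter_eq']
  · split_ifs <;> simp
  · rw [Finset.disjoint_left]
    intro x hx hx'
    simp only [Finset.mem_filter] at hx hx'
    omega

lemma countLE_zero (R : Finset ℕ) : countLE R 0 = if 0 ∈ R then 1 else 0 := by
  have : R.filter (· ≤ 0) = R.filter (· = 0) := by
    ext x
    simp
  rw [countLE, this, Finset.filter_eq']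
  split_ifs <;> simp

/-- The ballot condition: in every initial segment at most half of the entries lie in `R`. -/
def Ballot (n : ℕ) (R : Finset ℕ) : Prop := ∀ p < n, 2 * countLE R p ≤ p + 1

/-- A two-row tableau is determined by its content vector. -/
lemma eq_of_contentOf_eq {n : ℕ} {R R' : Finset ℕ} (hR : Ballot n R) (hR' : Ballot n R')
    (hn : ∀ p ∈ R, p < n) (hn' : ∀ p ∈ R', p < n)
    (h : ∀ p < n, contentOf R p = contentOf R' p) : R = R' := by
  -- With equal counts c so far, suppose that p + 1 lies in R only. Equal contents mean (c + 1) - 2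
  -- = (p + 1) - c, that is 2c = p + 2, while the ballot condition for R gives 2(c + 1) ≤ p + 2. The
  -- element 0 lies in neither set.
  have key : ∀ p < n, countLE R p = countLE R' p ∧ (p ∈ R ↔ p ∈ R') := by
    intro p
    induction p with
    | zero =>
      intro hp
      have h1 := h 0 hp
      have h2 := hR 0 hp
      have h3 := hR' 0 hp
      have h4 := countLE_zero R
      have h5 := countLE_zero R'
      simp only [contentOf] at h1
      by_cases h6 : 0 ∈ R <;> by_cases h7 : 0 ∈ R' <;> simp [h6, h7] at * <;> omega
    | succ p ih =>
      intro hp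
      have h0 := (ih (by omega)).1
      have h1 := h _ hp
      have h2 := hR _ hp
      have h3 := hR' _ hp
      have h4 := countLE_succ R p
      have h5 := countLE_succ R' p
      simp only [contentOf] at h1
      by_cases h6 : p + 1 ∈ R <;> by_cases h7 : p + 1 ∈ R' <;>
        simp only [h6, h7, if_true, if_false] at h1 h4 h5 ⊢ <;>
        refine ⟨?_, ?_⟩ <;> first | omega | simp
  ext p
  constructor
  · intro hp
    exact ((key p (hn p hp)).2).1 hp
  · intro hp
    exact ((key p (hn' p hp)).2).2 hp

lemma countLE_image {m : ℕ} {e : Fin m → ℕ} (he : StrictMono e) (r : Fin m) :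
    countLE (Finset.univ.image e) (e r) = r + 1 := by
  have : (Finset.univ.image e).filter (· ≤ e r) = (Finset.Iic r).image e := by
    ext x
    simp only [Finset.mem_filter, Finset.mem_image, Finset.mem_univ, true_and, Finset.mem_Iic]
    constructor
    · rintro ⟨⟨q, rfl⟩, h⟩
      exact ⟨q, he.le_iff_le.1 h, rfl⟩
    · rintro ⟨q, h, rfl⟩
      exact ⟨⟨q, rfl⟩, he.le_iff_le.2 h⟩
  rw [countLE, this, Finset.card_image_of_injective _ he.injective, Fin.card_Iic]

/-- How contents change when the entry `a` in the second row trades places with the entry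
`a + 1` in the first row. -/
lemma contentOf_move {m : ℕ} {e e' : Fin m → ℕ} (he : StrictMono e) (he' : StrictMono e')
    {r : Fin m} (hr : e' r = e r + 1) (hq : ∀ q, q ≠ r → e' q = e q) :
    contentOf (Finset.univ.image e') (e r) = contentOf (Finset.univ.image e) (e r + 1) ∧
    contentOf (Finset.univ.image e') (e r + 1) = contentOf (Finset.univ.image e) (e r) ∧
    (∀ k, k ≠ e r → k ≠ e r + 1 →
      contentOf (Finset.univ.image e') k = contentOf (Finset.univ.image e) k) ∧
    contentOf (Finset.univ.image e) (e r) - contentOf (Finset.univ.image e) (e r + 1)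
      = 2 * r - 1 - e r := by
  set R := Finset.univ.image e with hRdef
  set R' := Finset.univ.image e' with hRdef'
  have m1 : e r ∈ R := Finset.mem_image_of_mem _ (Finset.mem_univ _)
  have m2 : e r + 1 ∈ R' := by
    rw [← hr]
    exact Finset.mem_image_of_mem _ (Finset.mem_univ _)
  have m3 : e r + 1 ∉ R := by
    simp only [hRdef, Finset.mem_image, Finset.mem_univ, true_and, not_exists]
    intro q hqe
    by_cases h : q = r
    · subst h; omega
    · exact h (he'.injective (by rw [hq q h, hqe, hr]))
  have m4 : e r ∉ R' := by
    simp only [hRdef', Finset.mem_image, Finset.mem_univ, true_and, not_exists]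
    intro q hqe
    by_cases h : q = r
    · subst h; omega
    · exact h (he.injective (by rw [← hq q h, hqe]))
  have m5 : ∀ k, k ≠ e r → k ≠ e r + 1 → (k ∈ R' ↔ k ∈ R) := by
    intro k h1 h2
    simp only [hRdef, hRdef', Finset.mem_image, Finset.mem_univ, true_and]
    refine exists_congr fun q => ?_
    by_cases h : q = r
    · subst h
      omega
    · rw [hq q h]
  have c1 : countLE R (e r) = r + 1 := countLE_image he r
  have c2 : countLE R' (e r + 1) = r + 1 := by rw [← hr]; exact countLE_image he' r
  have c3 : countLE R (e r + 1) = r + 1 := by simp [countLE_succ, m3, c1]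
  have c4 : countLE R' (e r) = r := by
    have := countLE_succ R' (e r)
    simp only [m2, if_true] at this
    omega
  have c5 : ∀ k, k < e r → countLE R' k = countLE R k := by
    intro k hk
    unfold countLE
    congr 1
    ext x
    simp only [Finset.mem_filter]
    refine and_congr_left fun h => m5 x (by omega) (by omega)
  have c6 : ∀ k, countLE R' (e r + 1 + k) = countLE R (e r + 1 + k) := by
    intro k
    induction k with
    | zero => rw [add_zero, c2, c3]
    | succ k ih =>
      rw [← add_assoc, countLE_succ, countLE_succ, ih]
      simp only [m5 (e r + 1 + k + 1) (by omega) (by omega)]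
  refine ⟨?_, ?_, ?_, ?_⟩
  · simp only [contentOf, m4, m3, if_false, c4, c3]
    push_cast
    ring
  · simp only [contentOf, m1, m2, if_true, c1, c2]
  · intro k h1 h2
    have hc : countLE R' k = countLE R k := by
      rcases Nat.lt_or_ge k (e r) with h | h
      · exact c5 k h
      · obtain ⟨t, rfl⟩ : ∃ t, k = e r + 1 + t := ⟨k - (e r + 1), by omega⟩
        exact c6 t
    simp only [contentOf, m5 k h1 h2, hc]
  · simp only [contentOf, m1, m3, if_true, if_false, c1, c3]
    push_cast
    ring

/-! ### The seminormal construction -/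

/-- Interpolates between the second row `1, 3, …` (counted from `0`) of the column reading
tableau and the second row `e`. -/
def partialRow {m : ℕ} (e : Fin m → ℕ) (r : ℕ) (q : Fin m) : ℕ :=
  if (q : ℕ) < r then 2 * q + 1 else e q

/-- While the entry of column r climbs from 2r+1 to `e r`, it stays above the unmoved entries on its
left and below those on its right, which have already reached their final places. -/
lemma strictMono_update_partialRow {m : ℕ} {e : Fin m → ℕ} (he : StrictMono e) (r : Fin m)
    {t : ℕ} (ht : 2 * r + 1 + t ≤ e r) :
    StrictMono (Function.update (partialRow e (r + 1)) r (2 * r + 1 + t)) := by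
  intro p q hpq
  have h1 := he hpq
  simp only [Function.update_apply, partialRow]
  have h2 : (p : ℕ) < q := hpq
  by_cases hp : p = r
  · subst hp
    have : q ≠ p := hpq.ne'
    simp only [if_true, this, if_false]
    rw [if_neg (by omega)]
    omega
  · by_cases hq : q = r
    · subst hq
      simp only [hp, if_false, if_true]
      rw [if_pos (by omega)]
      omega
    · have hp' : (p : ℕ) ≠ r := by rwa [ne_eq, ← Fin.ext_iff]
      have hq' : (q : ℕ) ≠ r := by rwa [ne_eq, ← Fin.ext_iff]
      simp only [hp, hq, if_false]
      by_cases h3 : (q : ℕ) < r + 1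
      · rw [if_pos h3, if_pos (by omega)]
        omega
      · rw [if_neg h3]
        by_cases h4 : (p : ℕ) < r + 1
        · rw [if_pos h4]
          have : r < q := by rw [Fin.lt_def]; omega
          have := he this
          omega
        · rw [if_neg h4]
          exact h1

/-- The effect of `τ_{2r+1+t} ⋯ τ_{2r+2}` on a content vector. -/
lemma content_tau_chain {n m : ℕ} {e : Fin m → ℕ} (he : StrictMono e) (hn : ∀ q, e q < n)
    (r : Fin m) {v : TensorSpace n}
    (hv : HasContent (contentOf (Finset.univ.image (partialRow e (r + 1)))) v) (t : ℕ)
    (ht : 2 * r + 1 + t ≤ e r) :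
    HasContent (contentOf (Finset.univ.image
        (Function.update (partialRow e (r + 1)) r (2 * r + 1 + t))))
      (((List.range' (2 * (r + 1)) t).reverse.map (tau n)).prod v) ∧
    innerPi (((List.range' (2 * (r + 1)) t).reverse.map (tau n)).prod v)
        (((List.range' (2 * (r + 1)) t).reverse.map (tau n)).prod v)
      = ((∏ k ∈ Finset.Icc 2 (t + 1), ((k : ℝ) ^ 2 - 1) / (k : ℝ) ^ 2 : ℝ) : ℂ)
        * innerPi v v := by
  induction t with
  | zero =>
    have : Function.update (partialRow e (r + 1)) r (2 * r + 1) = partialRow e (r + 1) := by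
      rw [Function.update_eq_self_iff, partialRow, if_pos (by omega)]
    simp [this, hv]
  | succ t ih =>
    obtain ⟨ih1, ih2⟩ := ih (by omega)
    have hlist : ((List.range' (2 * (r + 1 : ℕ)) (t + 1)).reverse.map (tau n)).prod
        = tau n (2 * (r + 1) + t) * ((List.range' (2 * (r + 1)) t).reverse.map (tau n)).prod := by
      rw [List.range'_concat]
      simp
    have hrn := hn r
    rw [hlist, Module.End.mul_apply]
    set w := ((List.range' (2 * (r + 1 : ℕ)) t).reverse.map (tau n)).prod v with hw
    rw [tau_eq (by omega) (by omega)]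
    set a : Fin n := ⟨2 * (r + 1) + t - 1, by omega⟩ with ha
    set b : Fin n := ⟨2 * (r + 1) + t, by omega⟩ with hb
    have hab : (a : ℕ) + 1 = b := by simp [ha, hb]; omega
    have hmove := contentOf_move (strictMono_update_partialRow he r (t := t) (by omega))
      (strictMono_update_partialRow he r (t := t + 1) (by omega)) (r := r)
      (by simp only [Function.update_self]; ring)
      (fun q hq => by simp only [Function.update_of_ne hq])
    simp only [Function.update_self] at hmove
    obtain ⟨g1, g2, g3, g4⟩ := hmove
    have ea : 2 * (r : ℕ) + 1 + t = a := by simp only [ha]; omega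
    have eb : 2 * (r : ℕ) + 1 + t + 1 = b := by simp only [hb]; omega
    simp only [eb] at g1 g2 g3 g4
    rw [ea] at ih1 g1 g2 g3 g4
    refine ⟨ih1.intertwiner hab g1 g2 g3, ?_⟩
    have hd := congrArg (fun z : ℤ => (z : ℝ)) g4
    -- By `g4` the contents differ by 2r - 1 - (2r + 1 + t) = -(t + 2); so 1 - 1/d² is the factor k
    -- = t + 2 of γ_Q.
    rw [ih1.innerPi_intertwiner hab (d := -((t : ℝ) + 2)) ?_ ?_, ih2, ← mul_assoc,
      ← Complex.ofReal_mul]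
    · congr 2
      rw [Finset.prod_Icc_succ_top (by omega : 2 ≤ t + 1 + 1), mul_comm]
      congr 1
      have : (t : ℝ) + 2 ≠ 0 := by positivity
      push_cast
      field_simp
      ring
    · have ea' : ((a : ℕ) : ℝ) = 2 * (r : ℕ) + 1 + t := by rw [← ea]; push_cast; ring
      push_cast at hd
      rw [hd, ea']
      ring
    · have : (t : ℝ) + 2 ≠ 0 := by positivity
      exact neg_ne_zero.2 this

/-- The last factor of the list acts first, so the invariant is indexed downwards from m to 0. -/
lemma ofFn_prod_induction {V : Type*} [AddCommGroup V] [Module ℂ V] {m : ℕ}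
    (g : Fin m → Module.End ℂ V) (P : ℕ → V → Prop) {f : V} (hf : P m f)
    (hstep : ∀ (r : Fin m) (v : V), P (r + 1) v → P r (g r v)) : P 0 ((List.ofFn g).prod f) := by
  induction m generalizing P with
  | zero => simpa using hf
  | succ m ih =>
    rw [List.ofFn_succ, List.prod_cons, Module.End.mul_apply]
    refine hstep 0 _ ?_
    exact ih (fun r => g r.succ) (fun r v => P (r + 1) v) hf fun r v h => hstep r.succ v h

/-- The content vector and the norm of a vector built by the seminormal construction. -/
lemma content_tau_prod {n m : ℕ} {e : Fin m → ℕ} (he : StrictMono e) (hn : ∀ q, e q < n)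
    (h2 : ∀ q : Fin m, 2 * (q : ℕ) + 1 ≤ e q) {f : TensorSpace n}
    (hf : HasContent (contentOf (Finset.univ.image fun q : Fin m => 2 * (q : ℕ) + 1)) f) :
    HasContent (contentOf (Finset.univ.image e))
      ((List.ofFn fun r : Fin m => ((List.range' (2 * (r + 1))
        (e r + 1 - 2 * (r + 1))).reverse.map (tau n)).prod).prod f) ∧
    innerPi ((List.ofFn fun r : Fin m => ((List.range' (2 * (r + 1))
        (e r + 1 - 2 * (r + 1))).reverse.map (tau n)).prod).prod f)
      ((List.ofFn fun r : Fin m => ((List.range' (2 * (r + 1))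
        (e r + 1 - 2 * (r + 1))).reverse.map (tau n)).prod).prod f)
      = ((∏ r : Fin m, ∏ k ∈ Finset.Icc 2 (e r + 1 - 2 * (r + 1) + 1),
          ((k : ℝ) ^ 2 - 1) / (k : ℝ) ^ 2 : ℝ) : ℂ) * innerPi f f := by
  set γ : Fin m → ℝ := fun r => ∏ k ∈ Finset.Icc 2 (e r + 1 - 2 * (r + 1) + 1),
    ((k : ℝ) ^ 2 - 1) / (k : ℝ) ^ 2 with hγ
  -- Invariant: once the factors with index at least r have acted, the entries in columns q ≥ r are
  -- final and those in columns q < r are still 2q + 1.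
  have key := ofFn_prod_induction (fun r : Fin m => ((List.range' (2 * (r + 1))
        (e r + 1 - 2 * (r + 1))).reverse.map (tau n)).prod)
    (fun r v => HasContent (contentOf (Finset.univ.image (partialRow e r))) v ∧
      innerPi v v = ((∏ q ∈ Finset.univ.filter (fun q : Fin m => r ≤ (q : ℕ)), γ q : ℝ) : ℂ)
        * innerPi f f) (f := f) ?_ ?_
  · refine ⟨?_, ?_⟩
    · have : partialRow e 0 = e := by funext q; simp [partialRow]
      have h := key.1
      rwa [this] at h
    · have h := key.2
      simpa using h
  · refine ⟨?_, ?_⟩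
    · have : partialRow e m = fun q : Fin m => 2 * (q : ℕ) + 1 := by
        funext q; simp [partialRow]
      rwa [this]
    · rw [Finset.filter_false_of_mem (fun q _ => by omega)]
      simp
  · rintro r v ⟨h3, h4⟩
    have h2r := h2 r
    obtain ⟨h5, h6⟩ := content_tau_chain he hn r h3 (e r + 1 - 2 * (r + 1)) (by omega)
    refine ⟨?_, ?_⟩
    · have : Function.update (partialRow e (r + 1)) r (2 * r + 1 + (e r + 1 - 2 * (r + 1)))
          = partialRow e r := by
        funext q
        simp only [Function.update_apply, partialRow]
        by_cases hq : q = r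
        · subst hq
          simp
          omega
        · have hq' : (q : ℕ) ≠ r := by rwa [ne_eq, ← Fin.ext_iff]
          rw [if_neg hq]
          congr 1
          simp
          omega
      rwa [this] at h5
    · have hset : Finset.univ.filter (fun q : Fin m => (r : ℕ) ≤ (q : ℕ))
          = insert r (Finset.univ.filter (fun q : Fin m => (r : ℕ) + 1 ≤ (q : ℕ))) := by
        ext q
        simp only [Finset.mem_filter, Finset.mem_univ, true_and, Finset.mem_insert, Fin.ext_iff]
        omega
      rw [h6, h4, hset, Finset.prod_insert (by simp), Complex.ofReal_mul, mul_assoc]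

/-! ### Contents of the column reading tableau -/

/-- Since dim V = 2, antisymmetrization over three places is zero. Concretely, two of the three bits
at a, b, r agree, and f vanishes wherever the bits at a and b agree. -/
lemma permOp_swap_add_permOp_swap {n : ℕ} {a b r : Fin n} (hab : a ≠ b) (har : a ≠ r)
    (hbr : b ≠ r) {f : TensorSpace n} (hf : permOp (Equiv.swap a b) f = -f) :
    permOp (Equiv.swap a r) f + permOp (Equiv.swap b r) f = f := by
  have h0 : ∀ x : BinTuple n, x a = x b → f x = 0 := by
    intro x hx
    have h := congrFun hf x
    rw [permOp_apply, Pi.neg_apply] at h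
    have : (fun i => x (Equiv.swap a b i)) = x := by
      funext i
      rw [Equiv.swap_apply_def]
      split_ifs with h1 h2
      · rw [h1, hx]
      · rw [h2, hx]
      · rfl
    rw [this] at h
    exact self_eq_neg.1 h
  funext x
  rw [Pi.add_apply, permOp_apply, permOp_apply]
  have hcase : x a = x b ∨ x a = x r ∨ x b = x r := by
    have := (x a).2
    have := (x b).2
    have := (x r).2
    simp only [Fin.ext_iff]
    omega
  have hid : ∀ p q : Fin n, x p = x q → (fun i => x (Equiv.swap p q i)) = x := by
    intro p q h
    funext i
    rw [Equiv.swap_apply_def]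
    split_ifs with h1 h2
    · rw [h1, h]
    · rw [h2, h]
    · rfl
  rcases hcase with h | h | h
  · rw [h0 x h]
    have h1 := congrFun hf (fun i => x (Equiv.swap b r i))
    rw [permOp_apply, Pi.neg_apply] at h1
    have : (fun i => x (Equiv.swap b r (Equiv.swap a b i)))
        = fun i => x (Equiv.swap a r i) := by
      funext i
      by_cases hia : i = a
      · subst hia; simp
      by_cases hib : i = b
      · subst hib
        rw [Equiv.swap_apply_right, Equiv.swap_apply_of_ne_of_ne hab har,
          Equiv.swap_apply_of_ne_of_ne hab.symm hbr, h]
      by_cases hir : i = r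
      · subst hir
        rw [Equiv.swap_apply_of_ne_of_ne hia hib, Equiv.swap_apply_right,
          Equiv.swap_apply_right, h]
      · rw [Equiv.swap_apply_of_ne_of_ne hia hib, Equiv.swap_apply_of_ne_of_ne hib hir,
          Equiv.swap_apply_of_ne_of_ne hia hir]
    rw [this] at h1
    rw [h1, neg_add_cancel]
  · rw [hid a r h, h0 (fun i => x (Equiv.swap b r i)), add_zero]
    rw [Equiv.swap_apply_left, Equiv.swap_apply_of_ne_of_ne hab har, h]
  · rw [hid b r h, h0 (fun i => x (Equiv.swap a r i)), zero_add]
    rw [Equiv.swap_apply_left, Equiv.swap_apply_of_ne_of_ne hab.symm hbr, h]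

lemma countLE_odd (m p : ℕ) :
    countLE (Finset.univ.image fun q : Fin m => 2 * (q : ℕ) + 1) p = min m ((p + 1) / 2) := by
  have hmem : ∀ x, x ∈ (Finset.univ.image fun q : Fin m => 2 * (q : ℕ) + 1)
      ↔ x % 2 = 1 ∧ x < 2 * m := by
    intro x
    simp only [Finset.mem_image, Finset.mem_univ, true_and]
    constructor
    · rintro ⟨q, rfl⟩
      have := q.2
      omega
    · rintro ⟨h1, h2⟩
      exact ⟨⟨x / 2, by omega⟩, by simp only; omega⟩
  induction p with
  | zero => rw [countLE_zero]; simp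
  | succ p ih =>
    rw [countLE_succ, ih]
    simp only [hmem]
    split_ifs <;> omega

/-- A vector which is alternating in the first `m` pairs of coordinates and symmetric in the
remaining coordinates has the contents of the column reading tableau. -/
lemma hasContent_columnReading {n m : ℕ} {f : TensorSpace n}
    (halt : ∀ q (h : 2 * q + 1 < n), q < m →
      permOp (Equiv.swap (⟨2 * q, by omega⟩ : Fin n) ⟨2 * q + 1, h⟩) f = -f)
    (hsym : ∀ i j : Fin n, 2 * m ≤ (i : ℕ) → 2 * m ≤ (j : ℕ) →
      permOp (Equiv.swap i j) f = f) :
    HasContent (contentOf (Finset.univ.image fun q : Fin m => 2 * (q : ℕ) + 1)) f := by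
  intro r
  set F : ℕ → TensorSpace n := fun i => if h : i < n then permOp (Equiv.swap ⟨i, h⟩ r) f else 0
    with hF
  have hsum : ∀ s, s ≤ n → ∑ i ∈ Finset.univ.filter (fun i : Fin n => (i : ℕ) < s),
      permOp (Equiv.swap i r) f = ∑ i ∈ Finset.range s, F i := by
    intro s hs
    refine Finset.sum_bij (fun i _ => (i : ℕ)) (by simp) (fun a _ b _ h => Fin.ext h) ?_ ?_
    · intro b hb
      have := Finset.mem_range.1 hb
      exact ⟨⟨b, by omega⟩, by simp [this], rfl⟩
    · intro i _
      simp [hF]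
  have hM : jucysMurphy r f = ∑ i ∈ Finset.range r, F i := by
    rw [← hsum r r.2.le, jucysMurphy, LinearMap.sum_apply]
    rfl
  have hrn := r.2
  -- Both members of a complete alternating pair to the left of r together contribute f. For odd r <
  -- 2m the partner of r adds a further -f; beyond the pairs each symmetric place adds f.
  have hpairs : ∀ q, q ≤ m → 2 * q ≤ r → ∑ i ∈ Finset.range (2 * q), F i = (q : ℂ) • f := by
    intro q
    induction q with
    | zero => simp
    | succ q ih =>
      intro h1 h2
      rw [show 2 * (q + 1) = 2 * q + 1 + 1 by ring, Finset.sum_range_succ, Finset.sum_range_succ,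
        ih (by omega) (by omega), add_assoc]
      have : F (2 * q) + F (2 * q + 1) = f := by
        simp only [hF]
        rw [dif_pos (by omega), dif_pos (by omega)]
        exact permOp_swap_add_permOp_swap (by simp) (by simp [Fin.ext_iff]; omega)
          (by simp [Fin.ext_iff]; omega) (halt q (by omega) (by omega))
      rw [this]
      push_cast
      rw [add_smul, one_smul]
  rw [hM, contentOf, countLE_odd]
  have hmem : (r : ℕ) ∈ (Finset.univ.image fun q : Fin m => 2 * (q : ℕ) + 1)
      ↔ (r : ℕ) % 2 = 1 ∧ (r : ℕ) < 2 * m := by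
    simp only [Finset.mem_image, Finset.mem_univ, true_and]
    constructor
    · rintro ⟨q, hq⟩
      have := q.2
      omega
    · rintro ⟨h1, h2⟩
      exact ⟨⟨r / 2, by omega⟩, by simp only; omega⟩
  by_cases hr : (r : ℕ) < 2 * m
  · by_cases hodd : (r : ℕ) % 2 = 1
    · obtain ⟨q, hq⟩ : ∃ q, (r : ℕ) = 2 * q + 1 := ⟨r / 2, by omega⟩
      rw [if_pos (hmem.2 ⟨hodd, hr⟩), hq, Finset.sum_range_succ, hpairs q (by omega) (by omega),
        show min m ((2 * q + 1 + 1) / 2) = q + 1 by omega]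
      have : F (2 * q) = -f := by
        simp only [hF]
        rw [dif_pos (by omega)]
        have h := halt q (by omega) (by omega)
        convert h using 4
        exact Fin.ext hq
      rw [this]
      push_cast
      module
    · obtain ⟨q, hq⟩ : ∃ q, (r : ℕ) = 2 * q := ⟨r / 2, by omega⟩
      rw [if_neg (fun h => hodd (hmem.1 h).1), hq, hpairs q (by omega) (by omega),
        show min m ((2 * q + 1) / 2) = q by omega]
      congr 1
      push_cast
      ring
  · rw [if_neg (fun h => hr (hmem.1 h).2), show min m (((r : ℕ) + 1) / 2) = m by omega,
      ← Finset.sum_range_add_sum_Ico _ (by omega : 2 * m ≤ (r : ℕ)), hpairs m le_rfl (by omega),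
      Finset.sum_congr rfl (g := fun _ => f)]
    · rw [Finset.sum_const, Nat.card_Ico, ← Nat.cast_smul_eq_nsmul ℂ, ← add_smul]
      congr 1
      rw [Nat.cast_sub (by omega)]
      push_cast
      ring
    · intro i hi
      rw [Finset.mem_Ico] at hi
      simp only [hF]
      rw [dif_pos (by omega)]
      exact hsym _ _ hi.1 (by omega)

/-! ### Splitting binary tuples -/

/-- The first `a` coordinates. -/
def front {a b n : ℕ} (h : a + b = n) (x : BinTuple n) : BinTuple a :=
  fun i => x (Fin.cast h (Fin.castAdd b i))

/-- The last `b` coordinates. -/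
def rest {a b n : ℕ} (h : a + b = n) (x : BinTuple n) : BinTuple b :=
  fun j => x (Fin.cast h (Fin.natAdd a j))

/-- The number of coordinates at which both tuples have a one. -/
def overlap {n : ℕ} (z x : BinTuple n) : ℕ :=
  (Finset.univ.filter fun i => z i = 1 ∧ x i = 1).card

lemma sum_front_rest {a b n : ℕ} (h : a + b = n) (F : BinTuple a → BinTuple b → ℂ) :
    ∑ x : BinTuple n, F (front h x) (rest h x) = ∑ u, ∑ v, F u v := by
  subst h
  rw [← Fintype.sum_prod_type']
  refine Fintype.sum_equiv (Fin.appendEquiv a b).symm _ _ fun x => ?_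
  rfl

lemma weight_split {a b n : ℕ} (h : a + b = n) (x : BinTuple n) :
    weight x = weight (front h x) + weight (rest h x) := by
  subst h
  simp only [weight, Finset.card_filter, Fin.sum_univ_add]
  rfl

lemma overlap_split {a b n : ℕ} (h : a + b = n) (z x : BinTuple n) :
    overlap z x = overlap (front h z) (front h x) + overlap (rest h z) (rest h x) := by
  subst h
  simp only [overlap, Finset.card_filter, Fin.sum_univ_add]
  rfl

/-- Binary tuples as sets of coordinates. -/
def supportEquiv (n : ℕ) : BinTuple n ≃ Finset (Fin n) where
  toFun x := Finset.univ.filter fun i => x i = 1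
  invFun S := tupleOf S
  left_inv x := by
    funext i
    simp only [tupleOf, Finset.mem_filter, Finset.mem_univ, true_and]
    split_ifs with h
    · exact h.symm
    · omega
  right_inv S := by
    ext i
    simp [tupleOf]

lemma basisVec_apply {n : ℕ} (S : Finset (Fin n)) (x : BinTuple n) :
    basisVec S x = if S = supportEquiv n x then 1 else 0 := by
  rw [basisVec, Pi.single_apply]
  congr 1
  rw [eq_iff_iff]
  exact (Equiv.eq_symm_apply (supportEquiv n)).trans eq_comm

lemma sum_basisVec_apply {n : ℕ} (i : ℕ) (x : BinTuple n) :
    (∑ S ∈ (Finset.univ : Finset (Fin n)).powersetCard i, basisVec S) x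
      = if weight x = i then 1 else 0 := by
  rw [Finset.sum_apply]
  simp only [basisVec_apply]
  rw [Finset.sum_ite_eq']
  simp only [Finset.mem_powersetCard_univ]
  rfl

lemma sum_weight {n : ℕ} (φ : ℕ → ℂ) :
    ∑ x : BinTuple n, φ (weight x) = ∑ i ∈ Finset.range (n + 1), (n.choose i : ℂ) * φ i := by
  have h := Finset.sum_powerset_apply_card φ (x := (Finset.univ : Finset (Fin n)))
  simp only [Finset.powerset_univ, Finset.card_univ, Fintype.card_fin, nsmul_eq_mul] at h
  rw [← h]
  exact Fintype.sum_equiv (supportEquiv n) _ _ fun x => rfl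

/-! ### Alternating tensors -/

lemma altVec_apply (p q : Fin 2) : altVec ![p, q] = ((q : ℕ) : ℂ) - ((p : ℕ) : ℂ) := by
  have h : ∀ x : BinTuple 2, altVec x
      = (if x = tupleOf {1} then 1 else 0) - (if x = tupleOf {0} then 1 else 0) := fun x => by
    simp [altVec, basisVec, Pi.single_apply]
  have e : ∀ x y : BinTuple 2, x = y ↔ x 0 = y 0 ∧ x 1 = y 1 := fun x y => by
    constructor
    · rintro rfl
      simp
    · rintro ⟨h0, h1⟩
      funext i
      fin_cases i
      · exact h0
      · exact h1
  rw [h]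
  simp only [e, tupleOf]
  fin_cases p <;> fin_cases q <;> simp

lemma tensorPow_altVec_apply {m : ℕ} (x : BinTuple (2 * m)) :
    tensorPow altVec m x = ∏ k : Fin m,
      (((x ⟨2 * k + 1, by omega⟩ : ℕ) : ℂ) - ((x ⟨2 * k, by omega⟩ : ℕ) : ℂ)) := by
  simp only [tensorPow, altVec_apply]

lemma tensorPow_altVec_succ {m : ℕ} (h : 2 + 2 * m = 2 * (m + 1)) (x : BinTuple (2 * (m + 1))) :
    tensorPow altVec (m + 1) x = (((front h x 1 : ℕ) : ℂ) - ((front h x 0 : ℕ) : ℂ))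
      * tensorPow altVec m (rest h x) := by
  rw [tensorPow_altVec_apply, tensorPow_altVec_apply, Fin.prod_univ_succ]
  congr 1
  refine Finset.prod_congr rfl fun k _ => ?_
  simp only [rest, Fin.val_succ]
  congr 4 <;> (rw [Fin.ext_iff]; simp; ring)

lemma sum_binTuple_two (F : Fin 2 → Fin 2 → ℂ) :
    ∑ x : BinTuple 2, F (x 0) (x 1) = F 0 0 + F 0 1 + (F 1 0 + F 1 1) := by
  rw [← Fin.sum_univ_two (fun b => F 1 b), ← Fin.sum_univ_two (fun b => F 0 b),
    ← Fin.sum_univ_two (fun a => ∑ b, F a b), ← Fintype.sum_prod_type']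
  exact Fintype.sum_equiv (finTwoArrowEquiv (Fin 2)) _ _ fun x => rfl

lemma weight_of_tensorPow_altVec_ne_zero {m : ℕ} (x : BinTuple (2 * m))
    (hx : tensorPow altVec m x ≠ 0) : weight x = m := by
  induction m with
  | zero => simp [weight]
  | succ m ih =>
    have h : 2 + 2 * m = 2 * (m + 1) := by ring
    rw [tensorPow_altVec_succ h] at hx
    rw [weight_split h, ih _ (right_ne_zero_of_mul hx), add_comm, add_left_cancel_iff]
    have h1 := left_ne_zero_of_mul hx
    have h2 : weight (front h x) = (if front h x 0 = 1 then 1 else 0)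
        + (if front h x 1 = 1 then 1 else 0) := by
      rw [weight, Finset.card_filter, Fin.sum_univ_two]
    rw [h2]
    generalize front h x 0 = p at *
    generalize front h x 1 = q at *
    fin_cases p <;> fin_cases q <;> simp at *

lemma sum_sq_tensorPow_altVec (m : ℕ) :
    ∑ x : BinTuple (2 * m), tensorPow altVec m x * tensorPow altVec m x = 2 ^ m := by
  induction m with
  | zero => simp [tensorPow]
  | succ m ih =>
    have h : 2 + 2 * m = 2 * (m + 1) := by ring
    simp only [tensorPow_altVec_succ h]
    rw [sum_front_rest h (fun u v => (((u 1 : ℕ) : ℂ) - ((u 0 : ℕ) : ℂ)) * tensorPow altVec m v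
      * ((((u 1 : ℕ) : ℂ) - ((u 0 : ℕ) : ℂ)) * tensorPow altVec m v))]
    have : ∀ u : BinTuple 2, ∑ v, (((u 1 : ℕ) : ℂ) - ((u 0 : ℕ) : ℂ)) * tensorPow altVec m v
      * ((((u 1 : ℕ) : ℂ) - ((u 0 : ℕ) : ℂ)) * tensorPow altVec m v)
      = (((u 1 : ℕ) : ℂ) - ((u 0 : ℕ) : ℂ)) ^ 2 * 2 ^ m := by
      intro u
      rw [← ih, Finset.mul_sum]
      exact Finset.sum_congr rfl fun v _ => by ring
    simp only [this]
    rw [sum_binTuple_two (fun p q => (((q : ℕ) : ℂ) - ((p : ℕ) : ℂ)) ^ 2 * 2 ^ m)]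
    simp
    ring

/-- The forward difference of a sequence. -/
def forwardDiff (h : ℕ → ℂ) (j : ℕ) : ℂ := h (j + 1) - h j

/-- One factor v_01 - v_10 contributes h(j+1) - h(j) against the bits (0,1) of x, the negative
against (1,0), and zero against equal bits. That is the entry of the factor at x times a forward
difference. -/
lemma sum_tensorPow_altVec_overlap {m : ℕ} (h : ℕ → ℂ) (j : ℕ) (x : BinTuple (2 * m)) :
    ∑ u, tensorPow altVec m u * h (overlap u x + j)
      = tensorPow altVec m x * forwardDiff^[m] h j := by
  induction m generalizing h j with
  | zero => simp [tensorPow, overlap]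
  | succ m ih =>
    have e : 2 + 2 * m = 2 * (m + 1) := by ring
    simp only [tensorPow_altVec_succ e, overlap_split e _ x]
    rw [sum_front_rest e (fun u v => (((u 1 : ℕ) : ℂ) - ((u 0 : ℕ) : ℂ)) * tensorPow altVec m v
      * h (overlap u (front e x) + overlap v (rest e x) + j))]
    have h1 : ∀ u : BinTuple 2, ∑ v, (((u 1 : ℕ) : ℂ) - ((u 0 : ℕ) : ℂ)) * tensorPow altVec m v
        * h (overlap u (front e x) + overlap v (rest e x) + j)
        = (((u 1 : ℕ) : ℂ) - ((u 0 : ℕ) : ℂ)) * (tensorPow altVec m (rest e x)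
          * forwardDiff^[m] h (overlap u (front e x) + j)) := by
      intro u
      rw [← ih, Finset.mul_sum]
      refine Finset.sum_congr rfl fun v _ => ?_
      rw [mul_assoc]
      congr 3
      ring
    simp only [h1]
    have h2 : ∀ u : BinTuple 2, overlap u (front e x)
        = (if u 0 = 1 ∧ front e x 0 = 1 then 1 else 0)
          + (if u 1 = 1 ∧ front e x 1 = 1 then 1 else 0) := fun u => by
      rw [overlap, Finset.card_filter, Fin.sum_univ_two]
    simp only [h2]
    rw [sum_binTuple_two (fun p q => (((q : ℕ) : ℂ) - ((p : ℕ) : ℂ)) *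
      (tensorPow altVec m (rest e x) * forwardDiff^[m] h
        ((if p = 1 ∧ front e x 0 = 1 then 1 else 0)
          + (if q = 1 ∧ front e x 1 = 1 then 1 else 0) + j))), Function.iterate_succ_apply']
    generalize front e x 0 = p
    generalize front e x 1 = q
    fin_cases p <;> fin_cases q <;> simp [forwardDiff, add_comm j 1] <;> ring

/-- By Pascal's rule, because the alternating sign turns the difference into a sum of neighbouring
binomial coefficients. -/
lemma iterate_forwardDiff_choose (M m : ℕ) :
    forwardDiff^[m] (fun j => (-1 : ℂ) ^ j * (M.choose j : ℂ))
      = fun j => (-1 : ℂ) ^ (m + j) * ((m + M).choose (m + j) : ℂ) := by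
  induction m with
  | zero => simp
  | succ m ih =>
    rw [Function.iterate_succ_apply', ih]
    funext j
    rw [forwardDiff, show m + 1 + M = (m + M) + 1 by ring, show m + 1 + j = (m + j) + 1 by ring,
      show m + (j + 1) = (m + j) + 1 by ring, Nat.choose_succ_succ]
    push_cast
    ring

/-! ### The vectors for the column reading tableau -/

lemma gT_apply {n m : ℕ} (hm : 2 * m ≤ n) (i : ℕ) (x : BinTuple n) :
    gT hm i x = tensorPow altVec m (front (Nat.add_sub_of_le hm) x)
      * if weight (rest (Nat.add_sub_of_le hm) x) = i then 1 else 0 := by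
  rw [← sum_basisVec_apply]
  rfl

lemma fT_apply {n m : ℕ} (hm : 2 * m ≤ n) (l : ℕ) (x : BinTuple n) :
    fT hm l x = tensorPow altVec m (front (Nat.add_sub_of_le hm) x)
      * (scalarT n m l (weight (rest (Nat.add_sub_of_le hm) x)) : ℂ) := by
  have hw := weight_le (rest (Nat.add_sub_of_le hm) x)
  rw [fT, Finset.sum_apply]
  simp only [Pi.smul_apply, smul_eq_mul, gT_apply]
  rw [Finset.sum_eq_single (weight (rest (Nat.add_sub_of_le hm) x))]
  · rw [if_pos rfl]
    ring
  · intro i _ hi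
    rw [if_neg hi.symm]
    ring
  · intro h
    simp only [Finset.mem_range] at h
    omega

lemma exists_perm_initial {n : ℕ} (y : BinTuple n) :
    ∃ w : Equiv.Perm (Fin n), ∀ i, y (w i) = 1 ↔ (i : ℕ) < weight y := by
  have hle := weight_le y
  have hc : Fintype.card {i : Fin n // (i : ℕ) < weight y}
      = Fintype.card {i : Fin n // y i = 1} := by
    rw [Fintype.card_subtype, Fintype.card_subtype, Fin.card_filter_val_lt, min_eq_right hle]
    rfl
  let e := Fintype.equivOfCardEq hc
  refine ⟨e.extendSubtype, fun i => ⟨fun h => ?_, fun h => e.extendSubtype_mem i h⟩⟩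
  by_contra h'
  exact e.extendSubtype_not_mem i h' h

/-- A permutation moving the ones of y to an initial segment changes no weights or overlaps. This
produces the segments {1,…,i} in the definition of T^{(ℓ)}_{m,n}(i). -/
lemma sum_overlap_eq {n : ℕ} (l : ℕ) (φ : ℕ → ℂ) (y : BinTuple n) :
    ∑ v : BinTuple n, (if weight v = l then φ (overlap v y) else 0)
      = ∑ S ∈ (Finset.univ : Finset (Fin n)).powersetCard l,
          φ (S.filter fun k : Fin n => (k : ℕ) < weight y).card := by
  obtain ⟨w, hw⟩ := exists_perm_initial y
  have h1 : (Finset.univ : Finset (Fin n)).powersetCard l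
      = Finset.univ.filter fun S : Finset (Fin n) => S.card = l := by
    ext S
    simp
  rw [h1, Finset.sum_filter]
  refine Fintype.sum_equiv ((compEquiv w).trans (supportEquiv n)) _ _ fun v => ?_
  have h2 : (((compEquiv w).trans (supportEquiv n)) v).card = weight v := weight_comp w v
  rw [h2]
  congr 2
  symm
  refine Finset.card_bij (fun i _ => w i) ?_ (by simp) ?_
  · intro i hi
    simpa [supportEquiv, compEquiv, ← hw] using hi
  · intro i hi
    refine ⟨w.symm i, ?_, by simp⟩
    simpa [supportEquiv, compEquiv, ← hw] using hi

/-- The operator with kernel `(-1)^{|z ∩ x|} C(|z|, |z ∩ x|)`. -/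
def signedBinomialOp (n : ℕ) : Module.End ℂ (TensorSpace n) where
  toFun f := fun x => ∑ z, f z * ((-1) ^ overlap z x * ((weight z).choose (overlap z x) : ℂ))
  map_add' f g := by
    funext x
    simp [add_mul, Finset.sum_add_distrib]
  map_smul' c f := by
    funext x
    simp only [Pi.smul_apply, smul_eq_mul, RingHom.id_apply, Finset.mul_sum]
    exact Finset.sum_congr rfl fun y _ => by ring

lemma signedBinomialOp_apply {n : ℕ} (f : TensorSpace n) (x : BinTuple n) :
    signedBinomialOp n f x
      = ∑ z, f z * ((-1) ^ overlap z x * ((weight z).choose (overlap z x) : ℂ)) := rfl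

lemma overlap_comp {n : ℕ} (w : Equiv.Perm (Fin n)) (z x : BinTuple n) :
    overlap (fun i => z (w i)) (fun i => x (w i)) = overlap z x := by
  unfold overlap
  exact Finset.card_bij (fun i _ => w i) (by simp) (by simp)
    (fun b hb => ⟨w.symm b, by simpa using hb, by simp⟩)

lemma commute_signedBinomialOp {n : ℕ} (w : Equiv.Perm (Fin n)) :
    Commute (signedBinomialOp n) (permOp w) := by
  refine LinearMap.ext fun f => funext fun x => ?_
  rw [Module.End.mul_apply, Module.End.mul_apply, signedBinomialOp_apply, permOp_apply,
    signedBinomialOp_apply]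
  refine Fintype.sum_equiv (compEquiv w) _ _ fun z => ?_
  change _ = f (fun i => z (w i)) * ((-1) ^ overlap (fun i => z (w i)) (fun i => x (w i))
    * ((weight fun i => z (w i)).choose (overlap (fun i => z (w i)) (fun i => x (w i))) : ℂ))
  rw [overlap_comp, weight_comp]
  rfl

/-- On the support of g_T^{m,ℓ} the weight is m + ℓ, so the upper index of the binomial coefficient
is constant. Summing over the front coordinates takes its m-th difference, and summing over the
remaining ones gives T^{(ℓ)}_{m,n}. -/
lemma signedBinomialOp_gT {n m : ℕ} (hm : 2 * m ≤ n) (l : ℕ) :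
    signedBinomialOp n (gT hm l) = fT hm l := by
  funext x
  set e := Nat.add_sub_of_le hm
  rw [signedBinomialOp_apply, fT_apply]
  have h1 : ∀ z : BinTuple n,
      gT hm l z * ((-1) ^ overlap z x * ((weight z).choose (overlap z x) : ℂ))
      = (fun (u : BinTuple (2 * m)) (v : BinTuple (n - 2 * m)) => tensorPow altVec m u *
        (if weight v = l then
          (-1) ^ (overlap u (front e x) + overlap v (rest e x)) *
            ((m + l).choose (overlap u (front e x) + overlap v (rest e x)) : ℂ) else 0))
        (front e z) (rest e z) := by
    intro z
    simp only [gT_apply]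
    rw [← overlap_split e z x, mul_assoc]
    by_cases h0 : tensorPow altVec m (front e z) = 0
    · rw [h0]
      simp
    · congr 1
      rw [weight_split e z, weight_of_tensorPow_altVec_ne_zero _ h0]
      split_ifs with h2
      · rw [h2, one_mul]
      · rw [zero_mul]
  simp only [h1]
  rw [sum_front_rest e (fun (u : BinTuple (2 * m)) (v : BinTuple (n - 2 * m)) =>
    tensorPow altVec m u * (if weight v = l then
          (-1) ^ (overlap u (front e x) + overlap v (rest e x)) *
            ((m + l).choose (overlap u (front e x) + overlap v (rest e x)) : ℂ) else 0)),
    Finset.sum_comm]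
  have h2 : ∀ v : BinTuple (n - 2 * m), ∑ u : BinTuple (2 * m), tensorPow altVec m u *
      (if weight v = l then (-1) ^ (overlap u (front e x) + overlap v (rest e x)) *
            ((m + l).choose (overlap u (front e x) + overlap v (rest e x)) : ℂ) else 0)
      = tensorPow altVec m (front e x) * (if weight v = l then
        (-1) ^ (m + overlap v (rest e x)) *
          ((2 * m + l).choose (m + overlap v (rest e x)) : ℂ) else 0) := by
    intro v
    split_ifs with hv
    · rw [sum_tensorPow_altVec_overlap (fun j => (-1 : ℂ) ^ j * ((m + l).choose j : ℂ)),
        iterate_forwardDiff_choose]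
      rw [show m + (m + l) = 2 * m + l by ring]
    · simp
  simp only [h2]
  rw [← Finset.mul_sum]
  congr 1
  rw [sum_overlap_eq l (fun j => (-1 : ℂ) ^ (m + j) * ((2 * m + l).choose (m + j) : ℂ)), scalarT]
  push_cast
  rfl

lemma fT_alt {n m : ℕ} (hm : 2 * m ≤ n) (l : ℕ) (q : ℕ) (h : 2 * q + 1 < n) (hq : q < m) :
    permOp (Equiv.swap (⟨2 * q, by omega⟩ : Fin n) ⟨2 * q + 1, h⟩) (fT hm l) = -fT hm l := by
  funext x
  rw [permOp_apply, Pi.neg_apply, fT_apply, fT_apply, ← neg_mul]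
  set e := Nat.add_sub_of_le hm
  set w := Equiv.swap (⟨2 * q, by omega⟩ : Fin n) ⟨2 * q + 1, h⟩ with hw
  congr 1
  · rw [tensorPow_altVec_apply, tensorPow_altVec_apply]
    -- The sign is attached to the only factor of the product that changes.
    have h1 : (-1 : ℂ) = ∏ k : Fin m, if k = ⟨q, hq⟩ then (-1 : ℂ) else 1 := by simp
    rw [← neg_one_mul, h1, ← Finset.prod_mul_distrib]
    refine Finset.prod_congr rfl fun k _ => ?_
    simp only [front]
    by_cases hk : k = ⟨q, hq⟩
    · subst hk
      rw [if_pos rfl]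
      have h2 : w (Fin.cast e (Fin.castAdd (n - 2 * m) ⟨2 * q, by omega⟩))
          = Fin.cast e (Fin.castAdd (n - 2 * m) ⟨2 * q + 1, by omega⟩) :=
        Equiv.swap_apply_left _ _
      have h3 : w (Fin.cast e (Fin.castAdd (n - 2 * m) ⟨2 * q + 1, by omega⟩))
          = Fin.cast e (Fin.castAdd (n - 2 * m) ⟨2 * q, by omega⟩) :=
        Equiv.swap_apply_right _ _
      rw [h2, h3]
      ring
    · rw [if_neg hk, one_mul]
      have hk' : (k : ℕ) ≠ q := fun h => hk (Fin.ext h)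
      rw [hw, Equiv.swap_apply_of_ne_of_ne, Equiv.swap_apply_of_ne_of_ne] <;>
        simp [Fin.ext_iff] <;> omega
  · congr 3
    funext j
    simp only [rest]
    congr 1
    exact Equiv.swap_apply_of_ne_of_ne (by simp [Fin.ext_iff]; omega)
      (by simp [Fin.ext_iff]; omega)

lemma fT_symm {n m : ℕ} (hm : 2 * m ≤ n) (l : ℕ) (i j : Fin n) (hi : 2 * m ≤ (i : ℕ))
    (hj : 2 * m ≤ (j : ℕ)) : permOp (Equiv.swap i j) (fT hm l) = fT hm l := by
  funext x
  rw [permOp_apply, fT_apply, fT_apply]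
  set e := Nat.add_sub_of_le hm
  have h1 : front e (fun k => x (Equiv.swap i j k)) = front e x := by
    funext k
    simp only [front]
    congr 1
    exact Equiv.swap_apply_of_ne_of_ne (by simp [Fin.ext_iff]; omega)
      (by simp [Fin.ext_iff]; omega)
  -- The total weight and the front are unchanged, hence so is the weight of the remaining
  -- coordinates.
  have h2 := weight_split e (fun k => x (Equiv.swap i j k))
  rw [weight_comp (Equiv.swap i j) x, weight_split e x, h1, add_left_cancel_iff] at h2
  rw [h1, ← h2]

lemma hasContent_fT {n m : ℕ} (hm : 2 * m ≤ n) (l : ℕ) :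
    HasContent (contentOf (Finset.univ.image fun q : Fin m => 2 * (q : ℕ) + 1)) (fT hm l) :=
  hasContent_columnReading (fT_alt hm l) (fT_symm hm l)

/-- The vector is real, and on its support |x| is m plus the weight of the last n - 2m coordinates.
So the sum factors: the front gives 2^m, and the rest is grouped by weight. -/
lemma innerPi_fT {n m : ℕ} (hm : 2 * m ≤ n) (l : ℕ) :
    innerPi (fT hm l) (fT hm l) = (((2 ^ m / ((n : ℝ) + 1)) *
          ∑ i ∈ Finset.range (n - 2 * m + 1),
            scalarT n m l i ^ 2 * ((n - 2 * m).choose i : ℝ) / (n.choose (m + i) : ℝ) : ℝ) : ℂ) := by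
  set e := Nat.add_sub_of_le hm
  set G : BinTuple (2 * m) → BinTuple (n - 2 * m) → ℂ := fun u v =>
    (tensorPow altVec m u * tensorPow altVec m u) * ((scalarT n m l (weight v) : ℂ) ^ 2
      * (1 / (((n : ℂ) + 1) * (n.choose (m + weight v) : ℂ)))) with hG
  have hconj : ∀ u : BinTuple (2 * m),
      (starRingEnd ℂ) (tensorPow altVec m u) = tensorPow altVec m u := fun u => by
    simp [tensorPow_altVec_apply, map_prod]
  have h1 : innerPi (fT hm l) (fT hm l) = ∑ x : BinTuple n, G (front e x) (rest e x) := by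
    refine Finset.sum_congr rfl fun x _ => ?_
    rw [fT_apply]
    simp only [hG, map_mul, Complex.conj_ofReal, hconj]
    by_cases h0 : tensorPow altVec m (front e x) = 0
    · rw [h0]
      simp
    · rw [stationary, weight_split e x, weight_of_tensorPow_altVec_ne_zero _ h0]
      push_cast
      ring
  rw [h1, sum_front_rest e G]
  simp only [hG, ← Finset.mul_sum]
  rw [← Finset.sum_mul, sum_sq_tensorPow_altVec,
    sum_weight (fun i => (scalarT n m l i : ℂ) ^ 2 * (1 / (((n : ℂ) + 1) * (n.choose (m + i) : ℂ))))]
  push_cast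
  rw [Finset.mul_sum, Finset.mul_sum]
  refine Finset.sum_congr rfl fun i _ => ?_
  rw [one_div, mul_inv]
  ring

/-- For i = 0 all summands coincide, so nothing cancels; this is the term that makes the norm of f_T
positive. -/
lemma scalarT_zero_ne_zero {n m l : ℕ} (hl : l ≤ n - 2 * m) : scalarT n m l 0 ≠ 0 := by
  have h1 : (2 * m + l).choose m ≠ 0 := (Nat.choose_pos (by omega)).ne'
  have h2 : (n - 2 * m).choose l ≠ 0 := (Nat.choose_pos hl).ne'
  simp [scalarT, h1, h2]

lemma fT_ne_zero {n m l : ℕ} (hm : 2 * m ≤ n) (hl : l ≤ n - 2 * m) :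
    innerPi (fT hm l) (fT hm l) ≠ 0 := by
  rw [innerPi_fT, Complex.ofReal_ne_zero]
  refine mul_ne_zero (by positivity) (ne_of_gt ?_)
  refine Finset.sum_pos' (fun i _ => by positivity) ⟨0, by simp, ?_⟩
  have h1 := scalarT_zero_ne_zero hl
  have h2 : 0 < n.choose m := Nat.choose_pos (by omega)
  simp only [Nat.choose_zero_right, Nat.cast_one, mul_one, add_zero]
  positivity

/-! ### Permutations weighted by their number of cycles -/

/-- The normalized central binomial coefficient `C(2i, i) / 4^i`. -/
def arcsineCoeff (i : ℕ) : ℝ := (i.centralBinom : ℝ) / 4 ^ i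

lemma arcsineCoeff_zero : arcsineCoeff 0 = 1 := by simp [arcsineCoeff]

lemma succ_mul_arcsineCoeff_succ (i : ℕ) :
    ((i : ℝ) + 1) * arcsineCoeff (i + 1) = ((i : ℝ) + 1 / 2) * arcsineCoeff i := by
  have h := congrArg (fun k : ℕ => (k : ℝ)) (Nat.succ_mul_centralBinom_succ i)
  push_cast at h
  simp only [arcsineCoeff]
  rw [← mul_div_assoc, h, pow_succ]
  field_simp
  ring

lemma arcsineCoeff_succ (i : ℕ) :
    arcsineCoeff (i + 1) = (2 * (i : ℝ) + 1) / (2 * (i + 1)) * arcsineCoeff i := by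
  have h := succ_mul_arcsineCoeff_succ i
  have h2 : (i : ℝ) + 1 ≠ 0 := by positivity
  field_simp
  linear_combination 2 * h

/-- The number of two-colourings that are constant on the cycles of `s`. -/
def fixCard {α : Type*} (s : Equiv.Perm α) : ℕ :=
  Nat.card {f : α → Fin 2 // ∀ i, f (s i) = f i}

/-- The sum of `2^{-cycles(s)}` over all permutations `s`. -/
def cycleSum (α : Type*) [Fintype α] [DecidableEq α] : ℝ :=
  ∑ s : Equiv.Perm α, 1 / (fixCard s : ℝ)

lemma fixCard_permCongr {α β : Type*} (e : α ≃ β) (s : Equiv.Perm α) :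
    fixCard (e.permCongr s) = fixCard s := by
  refine Nat.card_congr ((Equiv.arrowCongr e (Equiv.refl (Fin 2))).symm.subtypeEquiv ?_)
  intro f
  simp only [Equiv.permCongr_apply]
  constructor
  · intro h i
    simpa using h (e i)
  · intro h i
    simpa using h (e.symm i)

lemma cycleSum_congr {α β : Type*} [Fintype α] [DecidableEq α] [Fintype β] [DecidableEq β]
    (e : α ≃ β) : cycleSum α = cycleSum β :=
  Fintype.sum_equiv e.permCongr _ _ fun s => by rw [fixCard_permCongr]

lemma fixCard_optionCongr {α : Type*} (s : Equiv.Perm α) :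
    fixCard (Equiv.optionCongr s) = 2 * fixCard s := by
  have h : 2 * fixCard s = Nat.card (Fin 2 × {f : α → Fin 2 // ∀ i, f (s i) = f i}) := by
    rw [Nat.card_prod, Nat.card_eq_fintype_card, Fintype.card_fin, fixCard]
  rw [h]
  exact Nat.card_congr
    { toFun := fun f => (f.1 none, ⟨fun i => f.1 (some i), fun i => f.2 (some i)⟩)
      invFun := fun p => ⟨fun o => o.elim p.1 p.2.1, fun o => by
        cases o with
        | none => rfl
        | some i => exact p.2.2 i⟩
      left_inv := fun f => by
        ext o
        cases o <;> rfl
      right_inv := fun p => rfl }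

/-- The new point is spliced into the cycle through a, so its colour is forced. -/
lemma fixCard_swap_mul_optionCongr {α : Type*} [DecidableEq α] (s : Equiv.Perm α) (a : α) :
    fixCard (Equiv.swap none (some a) * Equiv.optionCongr s) = fixCard s := by
  have key : ∀ f : Option α → Fin 2,
      (∀ o, f ((Equiv.swap none (some a) * Equiv.optionCongr s) o) = f o) →
      f (some a) = f none ∧ ∀ i, f (some (s i)) = f (some i) := by
    intro f hf
    have h1 : f (some a) = f none := by simpa using hf none
    refine ⟨h1, fun i => ?_⟩
    have h2 := hf (some i)
    simp only [Equiv.Perm.mul_apply, Equiv.optionCongr_apply, Option.map_some] at h2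
    rw [← h2]
    by_cases hi : s i = a
    · rw [hi, Equiv.swap_apply_right, h1]
    · rw [Equiv.swap_apply_of_ne_of_ne (by simp) (by simpa using hi)]
  refine Nat.card_congr
    { toFun := fun f => ⟨fun i => f.1 (some i), (key f.1 f.2).2⟩
      invFun := fun f => ⟨fun o => o.elim (f.1 a) f.1, fun o => ?_⟩
      left_inv := fun f => ?_
      right_inv := fun f => rfl }
  · cases o with
    | none => simp
    | some i =>
      simp only [Equiv.Perm.mul_apply, Equiv.optionCongr_apply, Option.map_some]
      by_cases hi : s i = a
      · rw [hi, Equiv.swap_apply_right]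
        simp [← hi, f.2 i]
      · rw [Equiv.swap_apply_of_ne_of_ne (by simp) (by simpa using hi)]
        exact f.2 i
  · ext o
    cases o with
    | none => simp [(key f.1 f.2).1]
    | some i => rfl

/-- Every permutation of `Option α` arises once from a permutation of `α`, either by adding `none`
as a new cycle (factor 1/2) or by inserting it into an existing cycle at one of the elements of `α`
(factor 1). -/
lemma cycleSum_option (α : Type*) [Fintype α] [DecidableEq α] :
    cycleSum (Option α) = ((Fintype.card α : ℝ) + 1 / 2) * cycleSum α := by
  have h : cycleSum (Option α) = ∑ p : Option α × Equiv.Perm α,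
      1 / (fixCard (Equiv.swap none p.1 * Equiv.optionCongr p.2) : ℝ) := by
    refine Fintype.sum_equiv Equiv.Perm.decomposeOption _ _ fun s => ?_
    have := Equiv.Perm.decomposeOption.symm_apply_apply s
    rw [Equiv.Perm.decomposeOption_symm_apply] at this
    rw [this]
  rw [h, Fintype.sum_prod_type, Fintype.sum_option]
  simp only [fixCard_swap_mul_optionCongr, Equiv.swap_self]
  have h2 : ∀ s : Equiv.Perm α,
      1 / (fixCard ((Equiv.refl (Option α) : Equiv.Perm (Option α)) * Equiv.optionCongr s) : ℝ)
      = 1 / 2 * (1 / (fixCard s : ℝ)) := fun s => by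
    have h3 : (Equiv.refl (Option α) : Equiv.Perm (Option α)) * Equiv.optionCongr s
        = Equiv.optionCongr s := one_mul _
    rw [h3, fixCard_optionCongr]
    push_cast
    rw [one_div_mul_one_div]
  simp only [h2]
  rw [← Finset.mul_sum, Finset.sum_const, Finset.card_univ, nsmul_eq_mul, cycleSum]
  ring

lemma cycleSum_eq {α : Type*} [Fintype α] [DecidableEq α] {k : ℕ} (hk : Fintype.card α = k) :
    cycleSum α = (k.factorial : ℝ) * arcsineCoeff k := by
  have key : ∀ k : ℕ, cycleSum (Fin k) = (k.factorial : ℝ) * arcsineCoeff k := by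
    intro k
    induction k with
    | zero => simp [cycleSum, fixCard, arcsineCoeff_zero]
    | succ k ih =>
      rw [cycleSum_congr (finSuccEquiv k), cycleSum_option, ih, Fintype.card_fin,
        Nat.factorial_succ]
      push_cast
      linear_combination (-(k.factorial : ℝ)) * succ_mul_arcsineCoeff_succ k
  rw [cycleSum_congr (Fintype.equivFinOfCardEq hk), key]

/-! ### Permutations preserving a colouring -/

/-- Permutations preserving a colouring are families of permutations of the colour classes. -/
def colourPreservingEquiv {α ι : Type*} (c : α → ι) :
    {s : Equiv.Perm α // ∀ a, c (s a) = c a} ≃ (∀ b, Equiv.Perm {a // c a = b}) where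
  toFun s b := s.1.subtypePerm fun a => by rw [s.2 a]
  invFun g := ⟨(Equiv.sigmaFiberEquiv c).permCongr (Equiv.Perm.sigmaCongrRight g), fun a => by
    simp only [Equiv.permCongr_apply, Equiv.sigmaFiberEquiv]
    exact (g (c a) ⟨a, rfl⟩).2⟩
  left_inv s := by
    ext a
    rfl
  right_inv g := by
    funext b
    ext ⟨a, rfl⟩
    rfl

/-- Cycles stay inside the colour classes, so an invariant two-colouring is an independent choice on
each class. -/
lemma fixCard_eq_prod {α ι : Type*} [Fintype ι] (c : α → ι)
    (s : {s : Equiv.Perm α // ∀ a, c (s a) = c a}) :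
    fixCard s.1 = ∏ b, fixCard (colourPreservingEquiv c s b) := by
  unfold fixCard
  rw [← Nat.card_pi]
  exact Nat.card_congr
    { toFun := fun f b => ⟨fun a => f.1 a.1, fun a => f.2 a.1⟩
      invFun := fun g => ⟨fun a => (g (c a)).1 ⟨a, rfl⟩, fun a => by
        have h := (g (c a)).2 ⟨a, rfl⟩
        -- The types of the two values depend on the classes `c (s a)` and `c a`; a free class `b`
        -- makes the transport between them trivial.
        have aux : ∀ (b : ι) (hb : c (s.1 a) = b), (g (c (s.1 a))).1 ⟨s.1 a, rfl⟩
            = (g b).1 ⟨s.1 a, hb⟩ := by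
          rintro b rfl
          rfl
        exact (aux _ (s.2 a)).trans h⟩
      left_inv := fun f => rfl
      right_inv := fun g => by
        funext b
        ext ⟨a, rfl⟩
        rfl }

lemma sum_colourPreserving {α ι : Type*} [Fintype α] [DecidableEq α] [Fintype ι] [DecidableEq ι]
    (c : α → ι) : ∑ s : {s : Equiv.Perm α // ∀ a, c (s a) = c a}, 1 / (fixCard s.1 : ℝ)
      = ∏ b, cycleSum {a // c a = b} := by
  unfold cycleSum
  rw [Finset.prod_univ_sum, Fintype.piFinset_univ]
  refine Fintype.sum_equiv (colourPreservingEquiv c) _ _ fun s => ?_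
  rw [fixCard_eq_prod, Nat.cast_prod]
  simp [Finset.prod_inv_distrib]

lemma card_colourPreserving {α ι : Type*} [Fintype α] [DecidableEq α] [Fintype ι]
    [DecidableEq ι] (c : α → ι) : Nat.card {s : Equiv.Perm α // ∀ a, c (s a) = c a}
      = ∏ b, (Fintype.card {a // c a = b}).factorial := by
  rw [Nat.card_congr (colourPreservingEquiv c), Nat.card_pi]
  refine Finset.prod_congr rfl fun b _ => ?_
  rw [Nat.card_eq_fintype_card, Fintype.card_perm]

/-! ### A closed form of the Burnside kernel -/

/-- The moments `E[p^i (1-p)^j]` of the arcsine law. -/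
def arcsineMoment (i j : ℕ) : ℝ :=
  (i.factorial : ℝ) * arcsineCoeff i * ((j.factorial : ℝ) * arcsineCoeff j)
    / ((i + j).factorial : ℝ)

/-- This is p + (1 - p) = 1 under the expectation. Algebraically the two terms have relative weights
i + 1/2 and j + 1/2 over i + j + 1. -/
lemma arcsineMoment_add (i j : ℕ) :
    arcsineMoment (i + 1) j + arcsineMoment i (j + 1) = arcsineMoment i j := by
  simp only [arcsineMoment]
  rw [show i + 1 + j = i + j + 1 by ring, show i + (j + 1) = i + j + 1 by ring,
    Nat.factorial_succ (i + j), Nat.factorial_succ i, Nat.factorial_succ j, arcsineCoeff_succ,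
    arcsineCoeff_succ]
  have h1 : ((i + j).factorial : ℝ) ≠ 0 := by positivity
  have h2 : (i : ℝ) + j + 1 ≠ 0 := by positivity
  push_cast
  field_simp
  ring

lemma smul_eq_iff_forall {n : ℕ} (s : Equiv.Perm (Fin n)) (x : BinTuple n) :
    s • x = x ↔ ∀ a, x (s a) = x a := by
  constructor
  · intro h a
    have : x (s⁻¹ (s a)) = x (s a) := congrFun h (s a)
    simpa using this.symm
  · intro h
    funext a
    change x (s⁻¹ a) = x a
    rw [← h (s⁻¹ a)]
    simp

lemma card_fixedBy {n : ℕ} (s : Equiv.Perm (Fin n)) :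
    Nat.card (MulAction.fixedBy (BinTuple n) s) = fixCard s :=
  Nat.card_congr (Equiv.subtypeEquivRight fun x => smul_eq_iff_forall s x)

/-- The permutations fixing x and y are those preserving the colouring a ↦ (x a, y a), so the sum
splits into four cycle sums. Dividing by the order |X|! |Xᶜ|! of the stabilizer of x groups them
into one moment for the ones of x and one for its zeros. -/
lemma burnsideKernel_eq {n : ℕ} (x y : BinTuple n) :
    burnsideKernel (Equiv.Perm (Fin n)) (BinTuple n) x y
      = arcsineMoment (supportEquiv n x ∩ supportEquiv n y).card
          (supportEquiv n x \ supportEquiv n y).card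
        * arcsineMoment ((supportEquiv n x)ᶜ ∩ supportEquiv n y).card
          ((supportEquiv n x)ᶜ \ supportEquiv n y).card := by
  have h1 : Nat.card (MulAction.stabilizer (Equiv.Perm (Fin n)) x)
      = (supportEquiv n x).card.factorial * (supportEquiv n x)ᶜ.card.factorial := by
    have h0 : Nat.card (MulAction.stabilizer (Equiv.Perm (Fin n)) x)
        = Nat.card {s : Equiv.Perm (Fin n) // ∀ a, x (s a) = x a} :=
      Nat.card_congr (Equiv.subtypeEquivRight fun s =>
        MulAction.mem_stabilizer_iff.trans (smul_eq_iff_forall s x))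
    rw [h0, card_colourPreserving, Fin.prod_univ_two, mul_comm]
    congr 2
    · rw [Fintype.card_subtype]
      rfl
    · rw [Fintype.card_subtype]
      congr 1
      ext i
      simp only [supportEquiv, Equiv.coe_fn_mk, Finset.mem_filter, Finset.mem_univ, true_and,
        Finset.mem_compl]
      omega
  have h2 : ∑ s : Equiv.Perm (Fin n) with s • x = x ∧ s • y = y,
      1 / (Nat.card (MulAction.fixedBy (BinTuple n) s) : ℝ)
      = ∏ b : Fin 2 × Fin 2, cycleSum {a // (x a, y a) = b} := by
    rw [← sum_colourPreserving]
    simp only [card_fixedBy]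
    refine Finset.sum_bij' (fun s hs => ⟨s, fun a => ?_⟩) (fun s _ => s.1) ?_ ?_ ?_ ?_ ?_
    · simp only [Finset.mem_filter, Finset.mem_univ, true_and, smul_eq_iff_forall] at hs
      rw [hs.1 a, hs.2 a]
    · simp
    · intro s _
      simp only [Finset.mem_filter, Finset.mem_univ, true_and, smul_eq_iff_forall]
      exact ⟨fun a => congrArg Prod.fst (s.2 a), fun a => congrArg Prod.snd (s.2 a)⟩
    · simp
    · simp
    · simp
  have hc : ∀ (b : Fin 2 × Fin 2) (S : Finset (Fin n)), (∀ a, a ∈ S ↔ (x a, y a) = b) →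
      cycleSum {a // (x a, y a) = b} = (S.card.factorial : ℝ) * arcsineCoeff S.card := by
    intro b S hS
    apply cycleSum_eq
    rw [Fintype.card_subtype]
    congr 1
    ext a
    simp [hS]
  unfold burnsideKernel
  rw [h1, h2, Fintype.prod_prod_type, Fin.prod_univ_two, Fin.prod_univ_two, Fin.prod_univ_two,
    hc (0, 0) ((supportEquiv n x)ᶜ \ supportEquiv n y)
      (by intro a; simp [supportEquiv]; omega),
    hc (0, 1) ((supportEquiv n x)ᶜ ∩ supportEquiv n y)
      (by intro a; simp [supportEquiv]; omega),
    hc (1, 0) (supportEquiv n x \ supportEquiv n y)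
      (by intro a; simp [supportEquiv]; omega),
    hc (1, 1) (supportEquiv n x ∩ supportEquiv n y) (by intro a; simp [supportEquiv])]
  simp only [arcsineMoment, Finset.card_inter_add_card_sdiff]
  push_cast
  field_simp

/-! ### Averaging against the arcsine law -/

/-- The expectation of `g` under the discrete arcsine law. -/
def arcsineSum (a : ℕ) (g : ℕ → ℝ) : ℝ :=
  ∑ p ∈ Finset.HasAntidiagonal.antidiagonal a, arcsineCoeff p.1 * arcsineCoeff p.2 * g p.1

/-- An element outside A does not affect g, so the terms with and without it merge by
`arcsineMoment_add`. Once B is empty, grouping by size turns C(|A|, i) times the moment into a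
product of two arcsine coefficients. -/
lemma sum_powerset_arcsineMoment {α : Type*} [DecidableEq α] (A B : Finset α)
    (hAB : Disjoint A B) (g : ℕ → ℝ) :
    ∑ Y ∈ (A ∪ B).powerset, arcsineMoment Y.card ((A ∪ B) \ Y).card * g (A ∩ Y).card
      = arcsineSum A.card g := by
  induction B using Finset.induction_on with
  | empty =>
    rw [Finset.union_empty]
    have h1 : ∀ Y ∈ A.powerset, arcsineMoment Y.card (A \ Y).card * g (A ∩ Y).card
        = (fun i => arcsineMoment i (A.card - i) * g i) Y.card := by
      intro Y hY
      rw [Finset.mem_powerset] at hY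
      rw [Finset.card_sdiff_of_subset hY, Finset.inter_eq_right.2 hY]
    rw [Finset.sum_congr rfl h1,
      Finset.sum_powerset_apply_card (fun i => arcsineMoment i (A.card - i) * g i), arcsineSum,
      Finset.Nat.sum_antidiagonal_eq_sum_range_succ_mk]
    refine Finset.sum_congr rfl fun i hi => ?_
    have hi' : i ≤ A.card := by
      rw [Finset.mem_range] at hi
      omega
    rw [nsmul_eq_mul, Nat.cast_choose ℝ hi', arcsineMoment, Nat.add_sub_cancel' hi']
    have := Nat.factorial_pos A.card
    have := Nat.factorial_pos i
    have := Nat.factorial_pos (A.card - i)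
    field_simp
  | insert e B he ih =>
    rw [Finset.disjoint_insert_right] at hAB
    have hne : e ∉ A ∪ B := by
      rw [Finset.mem_union]
      tauto
    rw [← ih hAB.2, Finset.union_insert, Finset.sum_powerset_insert hne, ← Finset.sum_add_distrib]
    refine Finset.sum_congr rfl fun Y hY => ?_
    rw [Finset.mem_powerset] at hY
    have heY : e ∉ Y := fun h => hne (hY h)
    rw [Finset.card_insert_of_notMem heY, Finset.insert_sdiff_insert,
      Finset.insert_sdiff_of_notMem _ heY, Finset.inter_insert_of_notMem hAB.1,
      Finset.card_insert_of_notMem (fun h => hne (Finset.mem_sdiff.1 h).1),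
      Finset.sdiff_insert_of_notMem hne, ← arcsineMoment_add Y.card ((A ∪ B) \ Y).card]
    ring

/-- Write a + 1 as the sum of the two indices and shift down the one that appears as a factor, using
(i+1)u_{i+1} = (i+1/2)u_i for the arcsine coefficients. -/
lemma arcsineSum_succ (a : ℕ) (g : ℕ → ℝ) :
    ((a : ℝ) + 1) * arcsineSum (a + 1) g
      = ∑ p ∈ Finset.HasAntidiagonal.antidiagonal a, arcsineCoeff p.1 * arcsineCoeff p.2
          * (((p.1 : ℝ) + 1 / 2) * g (p.1 + 1) + ((p.2 : ℝ) + 1 / 2) * g p.1) := by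
  have h1 : ((a : ℝ) + 1) * arcsineSum (a + 1) g
      = ∑ p ∈ Finset.HasAntidiagonal.antidiagonal (a + 1),
          (p.1 : ℝ) * arcsineCoeff p.1 * (arcsineCoeff p.2 * g p.1)
        + ∑ p ∈ Finset.HasAntidiagonal.antidiagonal (a + 1),
          (p.2 : ℝ) * arcsineCoeff p.2 * (arcsineCoeff p.1 * g p.1) := by
    rw [arcsineSum, Finset.mul_sum, ← Finset.sum_add_distrib]
    refine Finset.sum_congr rfl fun p hp => ?_
    have : (p.1 : ℝ) + p.2 = a + 1 := by exact_mod_cast Finset.HasAntidiagonal.mem_antidiagonal.1 hp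
    rw [← this]
    ring
  rw [h1, Finset.Nat.sum_antidiagonal_succ, Finset.Nat.sum_antidiagonal_succ']
  simp only [Nat.cast_zero, zero_mul, zero_add]
  rw [← Finset.sum_add_distrib]
  refine Finset.sum_congr rfl fun p _ => ?_
  push_cast
  rw [succ_mul_arcsineCoeff_succ, succ_mul_arcsineCoeff_succ]
  ring

/-- The signed binomial coefficient `(-1)^j C(N, j)`. -/
def signedChoose (N j : ℕ) : ℝ := (-1) ^ j * (N.choose j : ℝ)

lemma signedChoose_succ {N j k : ℕ} (h : j + k = N) :
    ((j : ℝ) + 1) * signedChoose N (j + 1) = -(k * signedChoose N j) := by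
  have h1 := congrArg (fun i : ℕ => (i : ℝ)) (Nat.choose_succ_right_eq N j)
  have h2 : N - j = k := by omega
  simp only [h2] at h1
  push_cast at h1
  simp only [signedChoose, pow_succ]
  linear_combination (-(-1 : ℝ) ^ j) * h1

/-- The value of the transition operator on the basic eigenfunctions. -/
def arcsineDoubleSum (a b : ℕ) : ℝ :=
  arcsineSum a fun i => arcsineSum b fun k => signedChoose (a + b) (i + k)

/-- Expand both sides by `arcsineSum_succ`. For each pair of index pairs the half-integers add up to
(j+1)c(j+1) + k c(j), where c is the signed binomial coefficient, j = p.1 + q.1 and k = p.2 + q.2 +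
1; this is zero since j + k = a + b + 1. -/
lemma arcsineDoubleSum_exchange (a b : ℕ) :
    ((a : ℝ) + 1) * arcsineDoubleSum (a + 1) b = -(((b : ℝ) + 1) * arcsineDoubleSum a (b + 1)) := by
  have h1 : ((b : ℝ) + 1) * arcsineDoubleSum a (b + 1)
      = ∑ p ∈ Finset.HasAntidiagonal.antidiagonal a, arcsineCoeff p.1 * arcsineCoeff p.2 *
        (((b : ℝ) + 1) * arcsineSum (b + 1) fun k => signedChoose (a + b + 1) (p.1 + k)) := by
    rw [arcsineDoubleSum, arcsineSum, Finset.mul_sum]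
    refine Finset.sum_congr rfl fun p _ => ?_
    simp only [show a + (b + 1) = a + b + 1 by ring]
    ring
  rw [h1, arcsineDoubleSum, arcsineSum_succ, ← add_eq_zero_iff_eq_neg, ← Finset.sum_add_distrib]
  refine Finset.sum_eq_zero fun p hp => ?_
  rw [← mul_add, arcsineSum_succ]
  simp only [arcsineSum]
  rw [Finset.mul_sum, Finset.mul_sum, ← Finset.sum_add_distrib, ← Finset.sum_add_distrib]
  apply mul_eq_zero_of_right
  refine Finset.sum_eq_zero fun q hq => ?_
  rw [Finset.HasAntidiagonal.mem_antidiagonal] at hp hq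
  have h2 := signedChoose_succ (N := a + b + 1) (j := p.1 + q.1) (k := p.2 + q.2 + 1)
    (by omega)
  simp only [show a + 1 + b = a + b + 1 by ring, show p.1 + 1 + q.1 = p.1 + q.1 + 1 by ring,
    show p.1 + (q.1 + 1) = p.1 + q.1 + 1 by ring]
  push_cast at h2
  linear_combination (arcsineCoeff q.1 * arcsineCoeff q.2) * h2

/-- As functions of a with a + b fixed, both sides obey the first-order recurrence of the signed
binomial coefficient. -/
lemma arcsineDoubleSum_eq (a b : ℕ) :
    arcsineDoubleSum a b = signedChoose (a + b) a * arcsineDoubleSum 0 (a + b) := by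
  induction a generalizing b with
  | zero => simp [signedChoose]
  | succ a ih =>
    have h1 := arcsineDoubleSum_exchange a b
    rw [ih (b + 1)] at h1
    have h2 := signedChoose_succ (N := a + b + 1) (j := a) (k := b + 1) (by ring)
    rw [show a + (b + 1) = a + b + 1 by ring] at h1
    rw [show a + 1 + b = a + b + 1 by ring]
    have h3 : (a : ℝ) + 1 ≠ 0 := by positivity
    apply mul_left_cancel₀ h3
    push_cast at h2
    linear_combination h1 - arcsineDoubleSum 0 (a + b + 1) * h2

/-- The summand of `arcsineDoubleSum 0 (p + q)`. -/
def alternatingTerm (p q : ℕ) : ℝ :=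
  (-1) ^ p * ((p + q).choose p : ℝ) * (arcsineCoeff p * arcsineCoeff q)

lemma arcsineDoubleSum_zero (N : ℕ) :
    arcsineDoubleSum 0 N = ∑ p ∈ Finset.HasAntidiagonal.antidiagonal N, alternatingTerm p.1 p.2 := by
  simp only [arcsineDoubleSum, arcsineSum, Finset.Nat.antidiagonal_zero, Finset.sum_singleton,
    arcsineCoeff_zero, zero_add, one_mul]
  refine Finset.sum_congr rfl fun p hp => ?_
  rw [alternatingTerm, Finset.HasAntidiagonal.mem_antidiagonal.1 hp, signedChoose]
  ring

/-- The certificate for the recurrence of `arcsineDoubleSum 0 N`. -/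
def alternatingCert (p q : ℕ) : ℝ :=
  ((p : ℝ) + 1) ^ 2 * (-4 * ((p : ℝ) + 1) ^ 3 + (8 * (p + q + 1) + 6) * ((p : ℝ) + 1) ^ 2
    - (12 * ((p : ℝ) + q + 1) + 2) * (p + 1)
    - ((p : ℝ) + q + 1) * (2 * (p + q + 1) - 3) * (2 * (p + q + 1) + 1))
    / (((p : ℝ) + q + 1) * (2 * q + 1) * (2 * p + 1)) * alternatingTerm (p + 1) q

/-- The Zeilberger identity: the summand of the recurrence is a difference of neighbouring
certificate values on the antidiagonal. After division by the common hypergeometric factor it is an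
identity of rational functions. -/
lemma alternatingCert_sub (p q : ℕ) :
    alternatingCert (p + 1) q - alternatingCert p (q + 1)
      = ((p : ℝ) + q + 2) ^ 2 * alternatingTerm (p + 1) (q + 1)
        - ((p : ℝ) + q + 1) ^ 2 * alternatingTerm p q := by
  have h1 : (((p + 1 + 1 + q).choose (p + 1 + 1) : ℕ) : ℝ)
      = ((p : ℝ) + q + 2) * (p + q + 1) / ((p + 2) * (p + 1)) * ((p + q).choose p : ℝ) := by
    rw [Nat.cast_add_choose, Nat.cast_add_choose, show p + 1 + 1 + q = p + q + 1 + 1 by ring,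
      Nat.factorial_succ, Nat.factorial_succ, Nat.factorial_succ (p + 1), Nat.factorial_succ p]
    have := Nat.factorial_pos p
    have := Nat.factorial_pos q
    push_cast
    field_simp
    ring
  have h2 : (((p + 1 + (q + 1)).choose (p + 1) : ℕ) : ℝ)
      = ((p : ℝ) + q + 2) * (p + q + 1) / ((q + 1) * (p + 1)) * ((p + q).choose p : ℝ) := by
    rw [Nat.cast_add_choose, Nat.cast_add_choose, show p + 1 + (q + 1) = p + q + 1 + 1 by ring,
      Nat.factorial_succ, Nat.factorial_succ, Nat.factorial_succ p, Nat.factorial_succ q]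
    have := Nat.factorial_pos p
    have := Nat.factorial_pos q
    push_cast
    field_simp
    ring
  simp only [alternatingCert, alternatingTerm]
  rw [h1, h2, arcsineCoeff_succ (p + 1), arcsineCoeff_succ p, arcsineCoeff_succ q, pow_succ,
    pow_succ]
  push_cast
  have e1 : (p : ℝ) + q + 2 ≠ 0 := by positivity
  have e2 : (p : ℝ) + 1 + q + 1 ≠ 0 := by positivity
  have e3 : (p : ℝ) + (q + 1) + 1 ≠ 0 := by positivity
  have e4 : 2 * (p : ℝ) + 1 ≠ 0 := by positivity
  have e5 : 2 * (q : ℝ) + 1 ≠ 0 := by positivity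
  have e6 : 2 * ((p : ℝ) + 1) + 1 ≠ 0 := by positivity
  have e7 : 2 * ((q : ℝ) + 1) + 1 ≠ 0 := by positivity
  have e8 : (p : ℝ) + 1 + 1 ≠ 0 := by positivity
  field_simp
  ring

lemma arcsineDoubleSum_zero_recurrence (N : ℕ) :
    ((N : ℝ) + 2) ^ 2 * arcsineDoubleSum 0 (N + 2)
      = ((N : ℝ) + 1) ^ 2 * arcsineDoubleSum 0 N := by
  have h1 : ∑ p ∈ Finset.HasAntidiagonal.antidiagonal N, (((N : ℝ) + 2) ^ 2 * alternatingTerm (p.1 + 1) (p.2 + 1)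
        - ((N : ℝ) + 1) ^ 2 * alternatingTerm p.1 p.2)
      = alternatingCert (N + 1) 0 - alternatingCert 0 (N + 1) := by
    have h2 := Finset.sum_range_sub (fun p => alternatingCert p (N + 1 - p)) (N + 1)
    simp only [Nat.sub_self, Nat.sub_zero] at h2
    rw [← h2, Finset.Nat.sum_antidiagonal_eq_sum_range_succ_mk]
    refine Finset.sum_congr rfl fun p hp => ?_
    rw [Finset.mem_range] at hp
    obtain ⟨q, rfl⟩ : ∃ q, N = p + q := ⟨N - p, by omega⟩
    rw [show p + q + 1 - (p + 1) = q by omega, show p + q + 1 - p = q + 1 by omega,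
      show p + q - p = q by omega, alternatingCert_sub]
    push_cast
    ring
  -- The telescoped sum covers only the interior terms of degree N + 2; the two boundary values of
  -- the certificate supply the missing end terms.
  have h3 : alternatingCert (N + 1) 0 = -(((N : ℝ) + 2) ^ 2 * alternatingTerm (N + 2) 0) := by
    simp only [alternatingCert, show N + 1 + 1 = N + 2 by ring]
    have e1 : (N : ℝ) + 2 ≠ 0 := by positivity
    have e2 : 2 * (N : ℝ) + 3 ≠ 0 := by positivity
    rw [← neg_mul]
    congr 1
    push_cast
    rw [div_eq_iff (by positivity)]
    ring
  have h4 : alternatingCert 0 (N + 1) = ((N : ℝ) + 2) ^ 2 * alternatingTerm 0 (N + 2) := by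
    simp only [alternatingCert, alternatingTerm]
    rw [show N + 2 = N + 1 + 1 by ring, arcsineCoeff_succ (N + 1), arcsineCoeff_succ 0,
      arcsineCoeff_zero, show 0 + 1 + (N + 1) = N + 1 + 1 by ring]
    simp only [zero_add, Nat.choose_one_right, Nat.choose_zero_right]
    have e2 : 2 * (N : ℝ) + 3 ≠ 0 := by positivity
    push_cast
    have e3 : 2 * ((N : ℝ) + 1) + 1 ≠ 0 := by positivity
    field_simp
    ring
  rw [arcsineDoubleSum_zero, arcsineDoubleSum_zero, Finset.Nat.sum_antidiagonal_succ,
    Finset.Nat.sum_antidiagonal_succ']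
  rw [Finset.sum_sub_distrib, ← Finset.mul_sum, ← Finset.mul_sum, h3, h4] at h1
  linear_combination h1

lemma arcsineDoubleSum_zero_eq (N : ℕ) :
    arcsineDoubleSum 0 N = if Even N then beta (N / 2) else 0 := by
  induction N using Nat.twoStepInduction with
  | zero => simp [arcsineDoubleSum_zero, alternatingTerm, arcsineCoeff_zero, beta]
  | one =>
    rw [arcsineDoubleSum_zero, Finset.Nat.sum_antidiagonal_succ]
    simp [alternatingTerm, arcsineCoeff_zero]
  | more N ih _ =>
    have h := arcsineDoubleSum_zero_recurrence N
    rw [ih] at h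
    have e1 : (N : ℝ) + 2 ≠ 0 := by positivity
    apply mul_left_cancel₀ (pow_ne_zero 2 e1)
    rw [h]
    by_cases hN : Even N
    · obtain ⟨k, rfl⟩ := hN
      rw [if_pos ⟨k, rfl⟩, if_pos ⟨k + 1, by ring⟩, show (k + k) / 2 = k by omega,
        show (k + k + 2) / 2 = k + 1 by omega]
      -- For N = 2k the recurrence has ratio ((2k+1)/(2k+2))², the square of the ratio of successive
      -- arcsine coefficients.
      have hb : ∀ k, beta k = arcsineCoeff k ^ 2 := by
        intro k
        rw [beta, arcsineCoeff, div_pow, Nat.centralBinom_eq_two_mul_choose, ← pow_mul]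
        congr 1
        rw [show (4 : ℝ) = 2 ^ 2 by norm_num, ← pow_mul]
        congr 1
        ring
      rw [hb, hb, arcsineCoeff_succ]
      have e2 : (k : ℝ) + 1 ≠ 0 := by positivity
      push_cast
      field_simp
      ring
    · rw [if_neg hN, if_neg (by rwa [Nat.even_add, iff_true_right (by decide)])]
      simp

/-! ### The transition operator on the basic eigenfunctions -/

lemma sum_finset_split {n : ℕ} (X : Finset (Fin n)) (F : Finset (Fin n) → Finset (Fin n) → ℝ) :
    ∑ Y : Finset (Fin n), F (X ∩ Y) (Xᶜ ∩ Y) = ∑ Y₁ ∈ X.powerset, ∑ Y₂ ∈ Xᶜ.powerset, F Y₁ Y₂ := by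
  rw [← Finset.sum_product']
  refine Finset.sum_bij' (fun Y _ => (X ∩ Y, Xᶜ ∩ Y)) (fun p _ => p.1 ∪ p.2) ?_ ?_ ?_ ?_ ?_
  · intro Y _
    simp [Finset.inter_subset_left]
  · simp
  · intro Y _
    rw [← Finset.union_inter_distrib_right]
    simp
  · rintro ⟨Y₁, Y₂⟩ h
    simp only [Finset.mem_product, Finset.mem_powerset] at h
    ext a
    · have h1 := @h.1 a
      have h2 := @h.2 a
      simp only [Finset.mem_compl, Finset.mem_inter, Finset.mem_union] at *
      tauto
    · have h1 := @h.1 a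
      have h2 := @h.2 a
      simp only [Finset.mem_compl, Finset.mem_inter, Finset.mem_union] at *
      tauto
  · simp

/-- The ones and the zeros of x are averaged separately. In each part only the coordinates in z
matter, which leaves the double sum with a = |z∩x| and b = |z∖x|. -/
lemma sum_burnsideKernel {n : ℕ} (z x : BinTuple n) :
    ∑ y, burnsideKernel (Equiv.Perm (Fin n)) (BinTuple n) x y
        * signedChoose (weight z) (overlap z y)
      = (if Even (weight z) then beta (weight z / 2) else 0)
        * signedChoose (weight z) (overlap z x) := by
  set X := supportEquiv n x with hX
  set Z := supportEquiv n z with hZ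
  have ho : ∀ y, overlap z y = (Z ∩ supportEquiv n y).card := fun y => by
    rw [overlap, hZ]
    congr 1
    ext i
    simp [supportEquiv]
  have hw : weight z = (Z ∩ X).card + (Z \ X).card := by
    rw [Finset.card_inter_add_card_sdiff]
    rfl
  set G : Finset (Fin n) → Finset (Fin n) → ℝ := fun Y₁ Y₂ =>
    arcsineMoment Y₁.card (X \ Y₁).card * (arcsineMoment Y₂.card (Xᶜ \ Y₂).card
      * signedChoose (weight z) (((Z ∩ X) ∩ Y₁).card + ((Z \ X) ∩ Y₂).card)) with hG
  have h1 : ∑ y, burnsideKernel (Equiv.Perm (Fin n)) (BinTuple n) x y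
        * signedChoose (weight z) (overlap z y) = ∑ Y, G (X ∩ Y) (Xᶜ ∩ Y) := by
    refine Fintype.sum_equiv (supportEquiv n) _ _ fun y => ?_
    rw [burnsideKernel_eq, ho]
    set Y := supportEquiv n y
    have e1 : Z ∩ Y = ((Z ∩ X) ∩ (X ∩ Y)) ∪ ((Z \ X) ∩ (Xᶜ ∩ Y)) := by
      ext a
      simp only [Finset.mem_inter, Finset.mem_union, Finset.mem_sdiff, Finset.mem_compl]
      tauto
    have e2 : Disjoint ((Z ∩ X) ∩ (X ∩ Y)) ((Z \ X) ∩ (Xᶜ ∩ Y)) := by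
      rw [Finset.disjoint_left]
      intro a
      simp only [Finset.mem_inter, Finset.mem_sdiff]
      tauto
    simp only [hG]
    rw [e1, Finset.card_union_of_disjoint e2, Finset.sdiff_inter_self_left,
      Finset.sdiff_inter_self_left]
    ring
  have hXu : X = (Z ∩ X) ∪ (X \ Z) := by
    ext a
    simp only [Finset.mem_inter, Finset.mem_union, Finset.mem_sdiff]
    tauto
  have hXc : Xᶜ = (Z \ X) ∪ (Xᶜ \ Z) := by
    ext a
    simp only [Finset.mem_union, Finset.mem_sdiff, Finset.mem_compl]
    tauto
  have h2 : ∀ g : ℕ → ℝ, ∑ Y ∈ X.powerset, arcsineMoment Y.card (X \ Y).card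
      * g ((Z ∩ X) ∩ Y).card = arcsineSum (Z ∩ X).card g := fun g => by
    rw [← sum_powerset_arcsineMoment (Z ∩ X) (X \ Z), ← hXu]
    rw [Finset.disjoint_left]
    intro a
    simp only [Finset.mem_inter, Finset.mem_sdiff]
    tauto
  have h3 : ∀ g : ℕ → ℝ, ∑ Y ∈ Xᶜ.powerset, arcsineMoment Y.card (Xᶜ \ Y).card
      * g ((Z \ X) ∩ Y).card = arcsineSum (Z \ X).card g := fun g => by
    rw [← sum_powerset_arcsineMoment (Z \ X) (Xᶜ \ Z), ← hXc]
    rw [Finset.disjoint_left]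
    intro a
    simp only [Finset.mem_sdiff]
    tauto
  rw [h1, sum_finset_split]
  simp only [hG, ← Finset.mul_sum]
  have h4 : ∀ i : ℕ, ∑ Y ∈ Xᶜ.powerset, arcsineMoment Y.card (Xᶜ \ Y).card
      * signedChoose (weight z) (i + ((Z \ X) ∩ Y).card)
      = arcsineSum (Z \ X).card fun k => signedChoose (weight z) (i + k) := fun i =>
    h3 fun k => signedChoose (weight z) (i + k)
  simp only [h4]
  rw [h2 (fun i => arcsineSum (Z \ X).card fun k => signedChoose (weight z) (i + k)), ho, hw]
  rw [← arcsineDoubleSum_zero_eq, mul_comm]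
  exact arcsineDoubleSum_eq _ _

/-! ### Operators diagonalized by the basic eigenfunctions -/

/-- The basic eigenfunction `x ↦ (-1)^{|z ∩ x|} C(|z|, |z ∩ x|)`. -/
def basicEigenfunction {n : ℕ} (z : BinTuple n) : TensorSpace n :=
  fun x => (signedChoose (weight z) (overlap z x) : ℂ)

lemma signedBinomialOp_eq_sum {n : ℕ} (f : TensorSpace n) :
    signedBinomialOp n f = ∑ z, f z • basicEigenfunction z := by
  funext x
  rw [signedBinomialOp_apply, Finset.sum_apply]
  refine Finset.sum_congr rfl fun z _ => ?_
  simp [basicEigenfunction, signedChoose]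

/-- Multiplication by a function of the weight. -/
def weightOp (n : ℕ) (φ : ℕ → ℝ) : Module.End ℂ (TensorSpace n) where
  toFun f := fun x => (φ (weight x) : ℂ) * f x
  map_add' f g := by
    funext x
    simp [mul_add]
  map_smul' c f := by
    funext x
    simp only [Pi.smul_apply, smul_eq_mul, RingHom.id_apply]
    ring

lemma weightOp_apply {n : ℕ} (φ : ℕ → ℝ) (f : TensorSpace n) (x : BinTuple n) :
    weightOp n φ f x = (φ (weight x) : ℂ) * f x := rfl

lemma commute_weightOp {n : ℕ} (φ : ℕ → ℝ) (w : Equiv.Perm (Fin n)) :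
    Commute (weightOp n φ) (permOp w) := by
  refine LinearMap.ext fun f => funext fun x => ?_
  rw [Module.End.mul_apply, Module.End.mul_apply, weightOp_apply, permOp_apply, permOp_apply,
    weightOp_apply, weight_comp]

lemma selfAdj_weightOp {n : ℕ} (φ : ℕ → ℝ) : SelfAdj (weightOp n φ) := fun f g => by
  refine Finset.sum_congr rfl fun x _ => ?_
  rw [weightOp_apply, weightOp_apply, map_mul, Complex.conj_ofReal]
  ring

lemma weightOp_gT {n m : ℕ} (hm : 2 * m ≤ n) (l : ℕ) (φ : ℕ → ℝ) :
    weightOp n φ (gT hm l) = (φ (m + l) : ℂ) • gT hm l := by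
  funext x
  rw [weightOp_apply, Pi.smul_apply, smul_eq_mul, gT_apply]
  by_cases h0 : tensorPow altVec m (front (Nat.add_sub_of_le hm) x) = 0
  · rw [h0]
    simp
  · rw [weight_split (Nat.add_sub_of_le hm) x, weight_of_tensorPow_altVec_ne_zero _ h0]
    split_ifs with h
    · rw [h]
    · simp

/-- An operator which is diagonal on the basic eigenfunctions, with eigenvalues depending only on
the weight, is diagonal on the vectors `f_Q`. -/
lemma apply_fQ_of_basic {n m : ℕ} {hm : 2 * m ≤ n} {A : Module.End ℂ (TensorSpace n)}
    {φ : ℕ → ℝ} (hA : ∀ z, A (basicEigenfunction z) = (φ (weight z) : ℂ) • basicEigenfunction z)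
    (Q : StdTableau n (twoRow n m hm)) (l : ℕ) : A (fQ Q l) = (φ (m + l) : ℂ) • fQ Q l := by
  -- A B = B Λ, by linearity from the action on the φ_z. Together with f_Q = B τ_Q g_T this moves A
  -- down to the weight of g_T.
  have h1 : ∀ f, A (signedBinomialOp n f) = signedBinomialOp n (weightOp n φ f) := by
    intro f
    rw [signedBinomialOp_eq_sum, signedBinomialOp_eq_sum, map_sum]
    refine Finset.sum_congr rfl fun z _ => ?_
    rw [map_smul, hA, smul_smul, weightOp_apply, mul_comm]
  have h2 : fQ Q l = signedBinomialOp n (tauQ Q (gT hm l)) := by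
    rw [fQ, ← signedBinomialOp_gT, ← Module.End.mul_apply, ← Module.End.mul_apply,
      (commute_tauQ commute_signedBinomialOp Q).eq]
  rw [h2, h1, ← Module.End.mul_apply (weightOp n φ), (commute_tauQ (commute_weightOp φ) Q).eq,
    Module.End.mul_apply, weightOp_gT, map_smul, map_smul]

lemma transition_basicEigenfunction {n : ℕ} (z : BinTuple n) :
    transition n (basicEigenfunction z)
      = (((if Even (weight z) then beta (weight z / 2) else 0 : ℝ)) : ℂ)
        • basicEigenfunction z := by
  funext x
  have h := congrArg (fun r : ℝ => (r : ℂ)) (sum_burnsideKernel z x)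
  simp only [Complex.ofReal_sum, Complex.ofReal_mul] at h
  exact h

lemma transition_fQ {n m : ℕ} {hm : 2 * m ≤ n} (Q : StdTableau n (twoRow n m hm)) (l : ℕ) :
    transition n (fQ Q l) = (if Even (m + l) then (beta ((m + l) / 2) : ℂ) else 0) • fQ Q l := by
  rw [apply_fQ_of_basic (φ := fun N => if Even N then beta (N / 2) else 0)
    transition_basicEigenfunction]
  congr 1
  split_ifs <;> simp

/-! ### A self-adjoint operator separating the weights -/

/-- Exchanging the values `0` and `1` at the place `j`. -/
def flip {n : ℕ} (j : Fin n) (x : BinTuple n) : BinTuple n := Function.update x j (1 - x j)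

lemma flip_flip {n : ℕ} (j : Fin n) (x : BinTuple n) : flip j (flip j x) = x := by
  simp [flip]

/-- The rate of the transition from `x` to `flip j x`. -/
def flipRate {n : ℕ} (j : Fin n) (x : BinTuple n) : ℝ :=
  if x j = 0 then (weight x : ℝ) + 1 else (n : ℝ) - weight x + 1

/-- The off-diagonal part of the Hahn difference operator. -/
def flipOp (n : ℕ) : Module.End ℂ (TensorSpace n) where
  toFun f := fun x => ∑ j, (flipRate j x : ℂ) * f (flip j x)
  map_add' f g := by
    funext x
    simp [mul_add, Finset.sum_add_distrib]
  map_smul' c f := by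
    funext x
    simp only [Pi.smul_apply, smul_eq_mul, RingHom.id_apply, Finset.mul_sum]
    exact Finset.sum_congr rfl fun y _ => by ring

lemma weight_flip {n : ℕ} (j : Fin n) (x : BinTuple n) :
    (weight (flip j x) : ℤ) = weight x + 1 - 2 * ((x j : ℕ) : ℤ) := by
  have h : ∀ y : BinTuple n, (weight y : ℤ) = ∑ i, ((y i : ℕ) : ℤ) := fun y => by
    rw [weight, Finset.card_filter]
    push_cast
    refine Finset.sum_congr rfl fun i _ => ?_
    generalize y i = p
    fin_cases p <;> simp
  rw [h, h, ← Finset.add_sum_erase _ _ (Finset.mem_univ j),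
    ← Finset.add_sum_erase _ (fun i => ((x i : ℕ) : ℤ)) (Finset.mem_univ j)]
  have h2 : ∑ i ∈ Finset.univ.erase j, ((flip j x i : ℕ) : ℤ)
      = ∑ i ∈ Finset.univ.erase j, ((x i : ℕ) : ℤ) := by
    refine Finset.sum_congr rfl fun i hi => ?_
    rw [flip, Function.update_of_ne (Finset.ne_of_mem_erase hi)]
  rw [h2, flip, Function.update_self]
  generalize x j = p
  fin_cases p <;> simp <;> ring

/-- Detailed balance: with w the smaller weight, (n - w)/C(n, w+1) = (w + 1)/C(n, w). -/
lemma flipRate_mul_stationary {n : ℕ} (j : Fin n) (x : BinTuple n) :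
    flipRate j (flip j x) * stationary (flip j x) = flipRate j x * stationary x := by
  have key : ∀ y : BinTuple n, y j = 0 →
      flipRate j (flip j y) * stationary (flip j y) = flipRate j y * stationary y := by
    intro y hy
    have h1 := weight_flip j y
    have h2 : weight (flip j y) = weight y + 1 := by
      rw [hy] at h1
      simp at h1
      omega
    have h3 := weight_le (flip j y)
    rw [h2] at h3
    have h4 : flip j y j ≠ 0 := by simp [flip, hy]
    have h5 := congrArg (fun k : ℕ => (k : ℝ)) (Nat.choose_succ_right_eq n (weight y))
    rw [flipRate, flipRate, if_neg h4, if_pos hy, stationary, stationary, h2]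
    have h6 : (n.choose (weight y) : ℝ) ≠ 0 := by
      exact_mod_cast (Nat.choose_pos (by omega)).ne'
    have h7 : (n.choose (weight y + 1) : ℝ) ≠ 0 := by
      exact_mod_cast (Nat.choose_pos h3).ne'
    have h8 : (n : ℝ) + 1 ≠ 0 := by positivity
    simp only [Nat.cast_mul, Nat.cast_sub (by omega : weight y ≤ n)] at h5
    push_cast at h5 ⊢
    field_simp
    linear_combination -h5
  by_cases hx : x j = 0
  · exact key x hx
  · have h1 : flip j x j = 0 := by
      simp only [flip, Function.update_self]
      omega
    have h2 := key _ h1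
    rw [flip_flip] at h2
    exact h2.symm

lemma selfAdj_flipOp {n : ℕ} : SelfAdj (flipOp n) := by
  intro f g
  change ∑ x, (∑ j, (flipRate j x : ℂ) * f (flip j x)) * (starRingEnd ℂ) (g x) * (stationary x : ℂ)
    = ∑ x, f x * (starRingEnd ℂ) (∑ j, (flipRate j x : ℂ) * g (flip j x)) * (stationary x : ℂ)
  simp only [map_sum, Finset.sum_mul, Finset.mul_sum]
  rw [Finset.sum_comm]
  conv_rhs => rw [Finset.sum_comm]
  refine Finset.sum_congr rfl fun j _ => ?_
  refine Fintype.sum_equiv ⟨flip j, flip j, flip_flip j, flip_flip j⟩ _ _ fun x => ?_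
  simp only [Equiv.coe_fn_mk, flip_flip, map_mul, Complex.conj_ofReal]
  have h := congrArg (fun r : ℝ => (r : ℂ)) (flipRate_mul_stationary j x)
  simp only [Complex.ofReal_mul] at h
  linear_combination (-f (flip j x) * (starRingEnd ℂ) (g x)) * h

/-- The operator `2D - ∑_{i,j} s_{ij} + (n - 2|x|)²`, where `D` is `flipOp`. -/
def separatingOp (n : ℕ) : Module.End ℂ (TensorSpace n) :=
  ((2 : ℝ) : ℂ) • flipOp n - ∑ i, ∑ j, permOp (Equiv.swap i j)
    + weightOp n fun w => ((n : ℝ) - 2 * w) ^ 2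

lemma selfAdj_separatingOp {n : ℕ} : SelfAdj (separatingOp n) :=
  ((selfAdj_flipOp.smul 2).sub (SelfAdj.sum _ fun i _ => SelfAdj.sum _ fun j _ =>
    selfAdj_swap i j)).add (selfAdj_weightOp _)

/-- The number of places with prescribed bits. -/
def bitCount {n : ℕ} (z x : BinTuple n) (p q : Fin 2) : ℕ :=
  (Finset.univ.filter fun i => z i = p ∧ x i = q).card

lemma sum_bits {n : ℕ} (z x : BinTuple n) (F : Fin 2 → Fin 2 → ℂ) :
    ∑ i, F (z i) (x i) = bitCount z x 0 0 * F 0 0 + bitCount z x 0 1 * F 0 1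
      + (bitCount z x 1 0 * F 1 0 + bitCount z x 1 1 * F 1 1) := by
  have h : ∀ i, F (z i) (x i) = ((if z i = 0 ∧ x i = 0 then 1 else 0) * F 0 0
      + (if z i = 0 ∧ x i = 1 then 1 else 0) * F 0 1)
      + ((if z i = 1 ∧ x i = 0 then 1 else 0) * F 1 0
      + (if z i = 1 ∧ x i = 1 then 1 else 0) * F 1 1) := fun i => by
    generalize z i = p
    generalize x i = q
    fin_cases p <;> fin_cases q <;> simp
  simp only [h, Finset.sum_add_distrib, ← Finset.sum_mul, bitCount, Finset.card_filter,
    Nat.cast_sum, Nat.cast_ite, Nat.cast_one, Nat.cast_zero]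

lemma overlap_eq_sum {n : ℕ} (z x : BinTuple n) :
    (overlap z x : ℤ) = ∑ i, ((z i : ℕ) : ℤ) * ((x i : ℕ) : ℤ) := by
  rw [overlap, Finset.card_filter]
  push_cast
  refine Finset.sum_congr rfl fun i _ => ?_
  generalize z i = p
  generalize x i = q
  fin_cases p <;> fin_cases q <;> simp

lemma overlap_flip {n : ℕ} (z x : BinTuple n) (j : Fin n) :
    (overlap z (flip j x) : ℤ) = overlap z x + ((z j : ℕ) : ℤ) * (1 - 2 * ((x j : ℕ) : ℤ)) := by
  rw [overlap_eq_sum, overlap_eq_sum, ← Finset.add_sum_erase _ _ (Finset.mem_univ j),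
    ← Finset.add_sum_erase _ (fun i => ((z i : ℕ) : ℤ) * ((x i : ℕ) : ℤ)) (Finset.mem_univ j)]
  have h2 : ∑ i ∈ Finset.univ.erase j, ((z i : ℕ) : ℤ) * ((flip j x i : ℕ) : ℤ)
      = ∑ i ∈ Finset.univ.erase j, ((z i : ℕ) : ℤ) * ((x i : ℕ) : ℤ) := by
    refine Finset.sum_congr rfl fun i hi => ?_
    rw [flip, Function.update_of_ne (Finset.ne_of_mem_erase hi)]
  rw [h2, flip, Function.update_self]
  generalize x j = p
  fin_cases p
  · simp
    ring
  · simp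

lemma overlap_swap {n : ℕ} (z x : BinTuple n) (i j : Fin n) :
    (overlap z (fun k => x (Equiv.swap i j k)) : ℤ)
      = overlap z x - (((z i : ℕ) : ℤ) - ((z j : ℕ) : ℤ)) * (((x i : ℕ) : ℤ) - ((x j : ℕ) : ℤ)) := by
  by_cases hij : i = j
  · subst hij
    simp
  rw [overlap_eq_sum, overlap_eq_sum, ← Finset.add_sum_erase _ _ (Finset.mem_univ i),
    ← Finset.add_sum_erase _ (fun k => ((z k : ℕ) : ℤ) * ((x k : ℕ) : ℤ)) (Finset.mem_univ i)]
  have hj : j ∈ Finset.univ.erase i := by simp [Ne.symm hij]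
  rw [← Finset.add_sum_erase _ _ hj,
    ← Finset.add_sum_erase _ (fun k => ((z k : ℕ) : ℤ) * ((x k : ℕ) : ℤ)) hj]
  have h2 : ∑ k ∈ (Finset.univ.erase i).erase j,
      ((z k : ℕ) : ℤ) * ((x (Equiv.swap i j k) : ℕ) : ℤ)
      = ∑ k ∈ (Finset.univ.erase i).erase j, ((z k : ℕ) : ℤ) * ((x k : ℕ) : ℤ) := by
    refine Finset.sum_congr rfl fun k hk => ?_
    rw [Finset.mem_erase, Finset.mem_erase] at hk
    rw [Equiv.swap_apply_of_ne_of_ne hk.2.1 hk.1]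
  rw [h2, Equiv.swap_apply_left, Equiv.swap_apply_right]
  ring

/-- A flip or a transposition changes the overlap a by at most 1, so the image involves only h(a-1),
h(a), h(a+1). Subtracting the transpositions leaves the coefficients 2a(b+1) and 2b(a+1) at the
neighbours, free of c and e. The recurrence of the signed binomial coefficient then reduces
everything to h(a), and the term (n - 2|x|)² makes the total independent of x. -/
lemma separatingOp_basicEigenfunction {n : ℕ} (z : BinTuple n) :
    separatingOp n (basicEigenfunction z)
      = ((2 * (n : ℝ) - 2 * (weight z : ℝ) * (weight z + 1) : ℝ) : ℂ) • basicEigenfunction z := by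
  funext x
  set a := bitCount z x 1 1 with ha
  set b := bitCount z x 1 0 with hb
  set c := bitCount z x 0 1 with hc
  set e := bitCount z x 0 0 with he
  have hov : overlap z x = a := rfl
  have hN : (weight z : ℂ) = b + a := by
    have h := sum_bits z x fun p _ => if p = 1 then 1 else 0
    simp only [Finset.sum_boole] at h
    simpa [weight] using h
  have hN' : weight z = a + b := by
    rw [add_comm]
    exact_mod_cast hN
  have hW : (weight x : ℂ) = c + a := by
    have h := sum_bits z x fun _ q => if q = 1 then 1 else 0
    simp only [Finset.sum_boole] at h
    simpa [weight] using h
  have hn : (n : ℂ) = e + c + (b + a) := by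
    have h := sum_bits z x fun _ _ => 1
    simpa using h
  -- Integer arguments let the overlap decrease without case distinctions. The meaningless value at
  -- -1 only occurs for a = 0, where its coefficient vanishes; hence the factor a kept in `hdown`.
  set h : ℤ → ℂ := fun t => (signedChoose (weight z) t.toNat : ℂ) with hh
  have hval : ∀ y, basicEigenfunction z y = h (overlap z y) := fun y => by
    simp [hh, basicEigenfunction]
  obtain ⟨F, hF⟩ : ∃ F : Fin 2 → Fin 2 → ℂ, F = fun p q : Fin 2 =>
      (if q = 0 then (weight x : ℂ) + 1 else (n : ℂ) - weight x + 1)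
        * h ((a : ℤ) + ((p : ℕ) : ℤ) * (1 - 2 * ((q : ℕ) : ℤ))) := ⟨_, rfl⟩
  obtain ⟨S, hS⟩ : ∃ S : Fin 2 → Fin 2 → Fin 2 → Fin 2 → ℂ, S = fun p q p' q' : Fin 2 =>
      h ((a : ℤ) - (((p : ℕ) : ℤ) - ((p' : ℕ) : ℤ)) * (((q : ℕ) : ℤ) - ((q' : ℕ) : ℤ))) :=
    ⟨_, rfl⟩
  have hflip : flipOp n (basicEigenfunction z) x = ∑ j, F (z j) (x j) := by
    change ∑ j, (flipRate j x : ℂ) * basicEigenfunction z (flip j x) = _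
    refine Finset.sum_congr rfl fun j _ => ?_
    rw [hval, overlap_flip, hov, flipRate, hF]
    congr 1
    split_ifs <;> simp
  have hswap : (∑ i, ∑ j, permOp (Equiv.swap i j)) (basicEigenfunction z) x
      = ∑ i, ∑ j, S (z i) (x i) (z j) (x j) := by
    rw [LinearMap.sum_apply, Finset.sum_apply]
    refine Finset.sum_congr rfl fun i _ => ?_
    rw [LinearMap.sum_apply, Finset.sum_apply]
    refine Finset.sum_congr rfl fun j _ => ?_
    rw [permOp_apply, hval, overlap_swap, hov, hS]
  have hup : ((a : ℂ) + 1) * h ((a : ℤ) + 1) = -(b * h a) := by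
    have h1 := congrArg (fun r : ℝ => (r : ℂ)) (signedChoose_succ (N := weight z) (j := a) hN'.symm)
    push_cast at h1
    simpa [hh, show ((a : ℤ) + 1).toNat = a + 1 by omega] using h1
  have hdown : (a : ℂ) * ((b + 1) * h ((a : ℤ) - 1)) = -(a * (a * h a)) := by
    rcases Nat.eq_zero_or_pos a with h0 | h0
    · simp [h0]
    · obtain ⟨a', h0'⟩ : ∃ a', a = a' + 1 := ⟨a - 1, by omega⟩
      have h1 := congrArg (fun r : ℝ => (r : ℂ))
        (signedChoose_succ (N := weight z) (j := a') (k := b + 1) (by omega))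
      push_cast at h1
      have h2 : h ((a : ℤ) - 1) = (signedChoose (weight z) a' : ℂ) := by
        simp only [hh]
        congr 3
        omega
      have h3 : h a = (signedChoose (weight z) (a' + 1) : ℂ) := by
        simp only [hh, h0']
        congr 2
      have h4 : (a : ℂ) = a' + 1 := by rw [h0']; push_cast; rfl
      rw [h2, h3, h4]
      linear_combination ((a' : ℂ) + 1) * h1
  rw [separatingOp, LinearMap.add_apply, LinearMap.sub_apply, LinearMap.smul_apply, Pi.add_apply,
    Pi.sub_apply, Pi.smul_apply, Pi.smul_apply, hflip, hswap, weightOp_apply, sum_bits z x F,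
    sum_bits z x (fun p q => ∑ j, S p q (z j) (x j)), hval, hov]
  simp only [fun p q => sum_bits z x (S p q)]
  rw [← ha, ← hb, ← hc, ← he, hF, hS]
  push_cast
  rw [hN, hW, hn]
  simp [show (a : ℤ) + -1 = a - 1 by ring]
  linear_combination 2 * b * hup + 2 * hdown

lemma separatingOp_fQ {n m : ℕ} {hm : 2 * m ≤ n} (Q : StdTableau n (twoRow n m hm)) (l : ℕ) :
    separatingOp n (fQ Q l) = ((2 * (n : ℝ) - 2 * ((m + l : ℕ) : ℝ) * ((m + l : ℕ) + 1) : ℝ) : ℂ)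
      • fQ Q l :=
  apply_fQ_of_basic (φ := fun N => 2 * (n : ℝ) - 2 * (N : ℝ) * (N + 1))
    separatingOp_basicEigenfunction Q l

lemma innerPi_fQ_of_ne {n m : ℕ} {hm : 2 * m ≤ n} (Q : StdTableau n (twoRow n m hm)) {l l' : ℕ}
    (h : l ≠ l') : innerPi (fQ Q l) (fQ Q l') = 0 := by
  refine selfAdj_separatingOp.orthogonal (separatingOp_fQ Q l) (separatingOp_fQ Q l') fun h1 => h ?_
  push_cast at h1
  -- N(N+1) is injective on the naturals: its difference at m + l and m + l' has this factorization
  -- with a positive second factor.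
  have h2 : ((l : ℝ) - l') * (2 * m + l + l' + 1) = 0 := by linear_combination (-1 / 2) * h1
  rcases mul_eq_zero.1 h2 with h3 | h3
  · exact_mod_cast sub_eq_zero.1 h3
  · exact absurd h3 (by positivity)

/-! ### Two-row tableaux and their second rows -/

lemma mem_cells_twoRow {n m : ℕ} (hm : 2 * m ≤ n) (i j : ℕ) :
    (i, j) ∈ (twoRow n m hm).cells ↔ (i = 0 ∧ j < n - m) ∨ (i = 1 ∧ j < m) := by
  rw [YoungDiagram.mem_cells, twoRow, YoungDiagram.mem_ofRowLens]
  constructor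
  · rintro ⟨h1, h2⟩
    simp only [List.length_cons, List.length_nil] at h1
    interval_cases i
    · exact Or.inl ⟨rfl, by simpa using h2⟩
    · exact Or.inr ⟨rfl, by simpa using h2⟩
  · rintro (⟨rfl, h⟩ | ⟨rfl, h⟩)
    · exact ⟨by simp, by simpa using h⟩
    · exact ⟨by simp, by simpa using h⟩

/-- The cells of a two-row diagram, the second row first. -/
def cellEquiv {n m : ℕ} (hm : 2 * m ≤ n) : Fin m ⊕ Fin (n - m) ≃ (twoRow n m hm).cells :=
  Equiv.ofBijective
    (Sum.elim (fun r => ⟨(1, (r : ℕ)), second_mem_twoRow hm r⟩)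
      (fun i => ⟨(0, (i : ℕ)), (mem_cells_twoRow hm _ _).2 (Or.inl ⟨rfl, i.2⟩)⟩)) (by
    constructor
    · rintro (r | i) (r' | i') h <;> simp [Fin.ext_iff] at h ⊢ <;> exact h
    · rintro ⟨⟨i, j⟩, h⟩
      rcases (mem_cells_twoRow hm i j).1 h with ⟨rfl, hj⟩ | ⟨rfl, hj⟩
      · exact ⟨Sum.inr ⟨j, hj⟩, rfl⟩
      · exact ⟨Sum.inl ⟨j, hj⟩, rfl⟩)

lemma cellEquiv_inl {n m : ℕ} (hm : 2 * m ≤ n) (r : Fin m) :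
    (cellEquiv hm (Sum.inl r)).1 = (1, (r : ℕ)) := rfl

lemma cellEquiv_inr {n m : ℕ} (hm : 2 * m ≤ n) (i : Fin (n - m)) :
    (cellEquiv hm (Sum.inr i)).1 = (0, (i : ℕ)) := rfl

/-- The second row of a tableau, with entries counted from `0`. -/
def lowerRow {n m : ℕ} {hm : 2 * m ≤ n} (Q : StdTableau n (twoRow n m hm)) (r : Fin m) : ℕ :=
  Q.entry (cellEquiv hm (Sum.inl r))

/-- The first row of a tableau, with entries counted from `0`. -/
def upperRow {n m : ℕ} {hm : 2 * m ≤ n} (Q : StdTableau n (twoRow n m hm)) (i : Fin (n - m)) :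
    ℕ := Q.entry (cellEquiv hm (Sum.inr i))

/-- The set of entries in the second row. -/
def lowerSet {n m : ℕ} {hm : 2 * m ≤ n} (Q : StdTableau n (twoRow n m hm)) : Finset ℕ :=
  Finset.univ.image (lowerRow Q)

section

variable {n m : ℕ} {hm : 2 * m ≤ n} (Q : StdTableau n (twoRow n m hm))

lemma strictMono_lowerRow : StrictMono (lowerRow Q) := fun _ _ h =>
  Q.row_strict _ _ rfl h

lemma strictMono_upperRow : StrictMono (upperRow Q) := fun _ _ h =>
  Q.row_strict _ _ rfl h

lemma upperRow_lt_lowerRow (r : Fin m) : upperRow Q ⟨r, by omega⟩ < lowerRow Q r :=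
  Q.col_strict _ _ rfl (by simp [cellEquiv_inl, cellEquiv_inr])

lemma lowerRow_lt (r : Fin m) : lowerRow Q r < n := Fin.is_lt _

lemma upperRow_ne_lowerRow (i : Fin (n - m)) (r : Fin m) : upperRow Q i ≠ lowerRow Q r := by
  intro h
  have := (cellEquiv hm).injective (Q.entry.injective (Fin.ext h))
  simp at this

/-- The r + 1 entries of the first row in columns 0,…,r and the r entries to the left in the second
row are distinct and smaller. -/
lemma two_mul_add_one_le_lowerRow (r : Fin m) : 2 * (r : ℕ) + 1 ≤ lowerRow Q r := by
  have hmn : ∀ i : Fin (r + 1), (i : ℕ) < n - m := fun i => by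
    have := i.2
    have := r.2
    omega
  have hcol := upperRow_lt_lowerRow Q r
  let φ : Fin (r + 1) ⊕ Fin r → Fin (lowerRow Q r) := Sum.elim
    (fun i => ⟨upperRow Q ⟨i, hmn i⟩, lt_of_le_of_lt ((strictMono_upperRow Q).le_iff_le.2
      (by rw [Fin.le_def]; simp only; omega)) hcol⟩)
    (fun i => ⟨lowerRow Q ⟨i, by omega⟩, strictMono_lowerRow Q (by
      rw [Fin.lt_def]; exact i.2)⟩)
  have hφ : Function.Injective φ := by
    rintro (i | i) (j | j) h <;> simp only [φ, Sum.elim_inl, Sum.elim_inr, Fin.mk.injEq] at h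
    · have := (strictMono_upperRow Q).injective h
      rw [Fin.mk.injEq] at this
      rw [Fin.ext this]
    · exact absurd h (upperRow_ne_lowerRow Q _ _)
    · exact absurd h.symm (upperRow_ne_lowerRow Q _ _)
    · have := (strictMono_lowerRow Q).injective h
      rw [Fin.mk.injEq] at this
      rw [Fin.ext this]
  have := Fintype.card_le_of_injective φ hφ
  simp only [Fintype.card_sum, Fintype.card_fin] at this
  omega

lemma card_lowerSet : (lowerSet Q).card = m := by
  rw [lowerSet, Finset.card_image_of_injective _ (strictMono_lowerRow Q).injective,
    Finset.card_univ, Fintype.card_fin]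

lemma lt_of_mem_lowerSet {p : ℕ} (hp : p ∈ lowerSet Q) : p < n := by
  obtain ⟨r, -, rfl⟩ := Finset.mem_image.1 hp
  exact lowerRow_lt Q r

lemma ballot_lowerSet : Ballot n (lowerSet Q) := by
  intro p _
  by_contra hcon
  have hk : 0 < countLE (lowerSet Q) p := by omega
  have hne : ((lowerSet Q).filter (· ≤ p)).Nonempty := Finset.card_pos.1 hk
  -- The count up to p equals the count up to the largest second-row entry not exceeding p, where
  -- the bound 2r + 1 applies.
  obtain ⟨x, hx, hmax⟩ := Finset.exists_max_image _ id hne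
  rw [Finset.mem_filter] at hx
  obtain ⟨r, -, rfl⟩ := Finset.mem_image.1 hx.1
  have h1 : countLE (lowerSet Q) p = countLE (lowerSet Q) (lowerRow Q r) := by
    unfold countLE
    congr 1
    ext y
    simp only [Finset.mem_filter]
    exact ⟨fun h => ⟨h.1, hmax y (Finset.mem_filter.2 h)⟩, fun h => ⟨h.1, h.2.trans hx.2⟩⟩
  rw [h1, lowerSet, countLE_image (strictMono_lowerRow Q)] at hcon
  have := two_mul_add_one_le_lowerRow Q r
  omega

end

lemma StdTableau.eq_of_entry {n : ℕ} {μ : YoungDiagram} {Q Q' : StdTableau n μ}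
    (h : Q.entry = Q'.entry) : Q = Q' := by
  cases Q
  cases Q'
  congr

lemma range_upperRow {n m : ℕ} {hm : 2 * m ≤ n} (Q : StdTableau n (twoRow n m hm)) :
    Set.range (upperRow Q) = {p | p < n ∧ p ∉ lowerSet Q} := by
  ext p
  simp only [Set.mem_range, Set.mem_ofPred_eq]
  constructor
  · rintro ⟨i, rfl⟩
    refine ⟨Fin.is_lt _, fun h => ?_⟩
    obtain ⟨r, -, hr⟩ := Finset.mem_image.1 h
    exact upperRow_ne_lowerRow Q i r hr.symm
  · rintro ⟨h1, h2⟩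
    obtain ⟨s, hs⟩ := ((cellEquiv hm).trans Q.entry).surjective ⟨p, h1⟩
    cases s with
    | inl r =>
      have hs' : lowerRow Q r = p := congrArg Fin.val hs
      exact absurd (Finset.mem_image.2 ⟨r, Finset.mem_univ _, hs'⟩) h2
    | inr i => exact ⟨i, congrArg Fin.val hs⟩

lemma eq_of_lowerSet_eq {n m : ℕ} {hm : 2 * m ≤ n} {Q Q' : StdTableau n (twoRow n m hm)}
    (h : lowerSet Q = lowerSet Q') : Q = Q' := by
  have h1 : lowerRow Q = lowerRow Q' := by
    rw [← (strictMono_lowerRow Q).range_inj (strictMono_lowerRow Q')]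
    have := congrArg (fun s : Finset ℕ => (s : Set ℕ)) h
    simpa [lowerSet] using this
  have h2 : upperRow Q = upperRow Q' := by
    rw [← (strictMono_upperRow Q).range_inj (strictMono_upperRow Q'), range_upperRow,
      range_upperRow, h]
  refine StdTableau.eq_of_entry (Equiv.ext fun c => ?_)
  obtain ⟨s, rfl⟩ := (cellEquiv hm).surjective c
  cases s with
  | inl r => exact Fin.ext (congrFun h1 r)
  | inr i => exact Fin.ext (congrFun h2 i)

/-- Every ballot set is the second row of a tableau. -/
lemma exists_lowerSet_eq {n : ℕ} {R : Finset ℕ} (hn : ∀ p ∈ R, p < n) (hR : Ballot n R)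
    (hm : 2 * R.card ≤ n) : ∃ Q : StdTableau n (twoRow n R.card hm), lowerSet Q = R := by
  set S : Finset (Fin n) := Finset.univ.filter fun i => (i : ℕ) ∈ R with hS
  have himg : S.image (fun i : Fin n => (i : ℕ)) = R := by
    ext p
    simp only [hS, Finset.mem_image, Finset.mem_filter, Finset.mem_univ, true_and]
    exact ⟨fun ⟨i, hi, h⟩ => h ▸ hi, fun h => ⟨⟨p, hn p h⟩, h, rfl⟩⟩
  have hc : S.card = R.card := by
    rw [← Finset.card_image_of_injective S Fin.val_injective, himg]
  have hc' : Sᶜ.card = n - R.card := by rw [Finset.card_compl, Fintype.card_fin, hc]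
  set σ := finSumEquivOfFinset hc hc' with hσ
  set lo : Fin R.card → ℕ := fun r => (σ (Sum.inl r) : ℕ) with hlo
  set up : Fin (n - R.card) → ℕ := fun i => (σ (Sum.inr i) : ℕ) with hup
  have hlo' : StrictMono lo := fun r r' h => by
    simp only [hlo, hσ, finSumEquivOfFinset_inl]
    exact (S.orderEmbOfFin hc).strictMono h
  have hup' : StrictMono up := fun r r' h => by
    simp only [hup, hσ, finSumEquivOfFinset_inr]
    exact (Sᶜ.orderEmbOfFin hc').strictMono h
  have hloR : Finset.univ.image lo = R := by
    refine Eq.trans ?_ himg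
    ext p
    simp only [hlo, hσ, finSumEquivOfFinset_inl, Finset.mem_image, Finset.mem_univ, true_and]
    constructor
    · rintro ⟨r, rfl⟩
      exact ⟨_, Finset.orderEmbOfFin_mem S hc r, rfl⟩
    · rintro ⟨i, hi, rfl⟩
      have : i ∈ Set.range (S.orderEmbOfFin hc) := by
        rw [Finset.range_orderEmbOfFin]
        exact hi
      obtain ⟨r, rfl⟩ := this
      exact ⟨r, rfl⟩
  have hcol : ∀ (r : Fin R.card) (i : Fin (n - R.card)), (r : ℕ) = i → up i < lo r := by
    intro r i hri
    by_contra hcon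
    -- If the column decreased, the numbers 0,…,`lo r` would lie among r + 1 lower and r upper
    -- entries, giving `lo r` + 1 ≤ 2r + 1. The ballot condition gives `lo r` + 1 ≥ 2(r + 1).
    have hsub : Finset.range (lo r + 1)
        ⊆ (Finset.Iic r).image lo ∪ (Finset.Iio i).image up := by
      intro k hk
      rw [Finset.mem_range] at hk
      have hkn : k < n := lt_of_lt_of_le hk (σ (Sum.inl r)).2
      obtain ⟨s, hs⟩ := σ.surjective ⟨k, hkn⟩
      rw [Finset.mem_union]
      cases s with
      | inl r' =>
        have hk' : lo r' = k := congrArg Fin.val hs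
        refine Or.inl (Finset.mem_image.2 ⟨r', ?_, hk'⟩)
        rw [Finset.mem_Iic, ← hlo'.le_iff_le, hk']
        omega
      | inr i' =>
        have hk' : up i' = k := congrArg Fin.val hs
        refine Or.inr (Finset.mem_image.2 ⟨i', ?_, hk'⟩)
        rw [Finset.mem_Iio, ← hup'.lt_iff_lt, hk']
        have hne : up i ≠ lo r := fun h => by
          have := σ.injective (Fin.ext h)
          simp at this
        omega
    have h1 := (Finset.card_le_card hsub).trans (Finset.card_union_le _ _)
    rw [Finset.card_range, Finset.card_image_of_injective _ hlo'.injective,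
      Finset.card_image_of_injective _ hup'.injective, Fin.card_Iic, Fin.card_Iio] at h1
    have h2 := hR (lo r) (σ (Sum.inl r)).2
    rw [← hloR, countLE_image hlo'] at h2
    omega
  refine ⟨⟨(cellEquiv hm).symm.trans σ, ?_, ?_⟩, ?_⟩
  · intro c d hrow hlt
    obtain ⟨s, rfl⟩ := (cellEquiv hm).surjective c
    obtain ⟨t, rfl⟩ := (cellEquiv hm).surjective d
    simp only [Equiv.trans_apply, Equiv.symm_apply_apply]
    rcases s with r | i <;> rcases t with r' | i' <;> simp [cellEquiv_inl, cellEquiv_inr] at hrow hlt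
    · exact hlo' hlt
    · exact hup' hlt
  · intro c d hrow hlt
    obtain ⟨s, rfl⟩ := (cellEquiv hm).surjective c
    obtain ⟨t, rfl⟩ := (cellEquiv hm).surjective d
    simp only [Equiv.trans_apply, Equiv.symm_apply_apply]
    rcases s with r | i <;> rcases t with r' | i' <;> simp [cellEquiv_inl, cellEquiv_inr] at hrow hlt
    exact hcol r' i hrow.symm
  · refine Eq.trans ?_ hloR
    refine congrArg (fun g => Finset.univ.image g) (funext fun r => ?_)
    simp [lowerRow, hlo]

/-! ### Counting the eigenvectors -/

lemma countLE_of_forall_lt {R : Finset ℕ} {n : ℕ} (h : ∀ p ∈ R, p < n) {p : ℕ} (hp : n ≤ p + 1) :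
    countLE R p = R.card := by
  rw [countLE, Finset.filter_true_of_mem]
  intro q hq
  have := h q hq
  omega

/-- There are at least `2 ^ n` pairs of a ballot set and an admissible degree. -/
lemma exists_ballot_family (n : ℕ) : ∃ T : Finset (Finset ℕ × ℕ), T.card = 2 ^ n ∧
    ∀ t ∈ T, (∀ p ∈ t.1, p < n) ∧ Ballot n t.1 ∧ t.2 + 2 * t.1.card ≤ n := by
  induction n with
  | zero => exact ⟨{(∅, 0)}, by simp, by simp [Ballot]⟩
  | succ n ih =>
    obtain ⟨T, hT, hprop⟩ := ih
    -- Each pair (R, l) has two successors: itself, and (R ∪ {n}, l). The latter is admissible only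
    -- for l < n - 2|R|; at the top degree l = n - 2|R| the new top degree l + 1 of R is used
    -- instead.
    let Φ : (Finset ℕ × ℕ) × Bool → Finset ℕ × ℕ := fun u =>
      if u.2 then (if u.1.2 + 2 * u.1.1.card = n then (u.1.1, u.1.2 + 1)
        else (insert n u.1.1, u.1.2)) else u.1
    refine ⟨(T ×ˢ Finset.univ).image Φ, ?_, ?_⟩
    · rw [Finset.card_image_of_injOn, Finset.card_product, hT, Finset.card_univ,
        Fintype.card_bool, pow_succ]
      rintro ⟨⟨R, l⟩, b⟩ h ⟨⟨R', l'⟩, b'⟩ h' heq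
      simp only [Finset.coe_product, Set.mem_prod, Finset.mem_coe] at h h'
      obtain ⟨h1, -, h2⟩ := hprop _ h.1
      obtain ⟨h1', -, h2'⟩ := hprop _ h'.1
      have hnR : n ∉ R := fun hh => absurd (h1 n hh) (lt_irrefl n)
      have hnR' : n ∉ R' := fun hh => absurd (h1' n hh) (lt_irrefl n)
      have hins : ∀ U U' : Finset ℕ, n ∉ U → U = insert n U' → False := fun U U' hU hh =>
        hU (hh ▸ Finset.mem_insert_self n U')
      have hinj : insert n R = insert n R' → R = R' := fun hh => by
        rw [← Finset.erase_insert hnR, hh, Finset.erase_insert hnR']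
      simp only at h2 h2'
      cases b <;> cases b' <;> simp only [Φ, if_true, if_false, Bool.false_eq_true] at heq
      · rw [heq]
      · split_ifs at heq with hc <;> rw [Prod.mk.injEq] at heq <;> obtain ⟨e1, e2⟩ := heq
        · subst e1
          omega
        · exact (hins _ _ hnR e1).elim
      · split_ifs at heq with hc <;> rw [Prod.mk.injEq] at heq <;> obtain ⟨e1, e2⟩ := heq
        · subst e1
          omega
        · exact (hins _ _ hnR' e1.symm).elim
      · split_ifs at heq with hc hc' <;> rw [Prod.mk.injEq] at heq <;> obtain ⟨e1, e2⟩ := heq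
        · subst e1
          rw [Nat.add_right_cancel e2]
        · exact (hins _ _ hnR e1).elim
        · exact (hins _ _ hnR' e1.symm).elim
        · rw [hinj e1, e2]
    · intro t ht
      obtain ⟨⟨⟨R, l⟩, b⟩, hu, rfl⟩ := Finset.mem_image.1 ht
      obtain ⟨h1, h2, h3⟩ := hprop _ (Finset.mem_product.1 hu).1
      simp only at h1 h2 h3
      have hnR : n ∉ R := fun hh => absurd (h1 n hh) (lt_irrefl n)
      have keep : (∀ p ∈ R, p < n + 1) ∧ Ballot (n + 1) R := by
        refine ⟨fun p hp => (h1 p hp).trans (Nat.lt_succ_self n), fun p hp => ?_⟩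
        rcases Nat.lt_or_ge p n with h | h
        · exact h2 p h
        · rw [countLE_of_forall_lt h1 (by omega)]
          omega
      cases b with
      | false =>
        simp only [Φ, Bool.false_eq_true, if_false]
        exact ⟨keep.1, keep.2, by omega⟩
      | true =>
        simp only [Φ, if_true]
        split_ifs with hc
        · exact ⟨keep.1, keep.2, by simp only; omega⟩
        · have hmem : ∀ p ∈ insert n R, p < n + 1 := by
            intro p hp
            rcases Finset.mem_insert.1 hp with rfl | hp
            · exact Nat.lt_succ_self p
            · exact keep.1 p hp
          refine ⟨hmem, fun p hp => ?_, ?_⟩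
          · rcases Nat.lt_or_ge p n with h | h
            · have : countLE (insert n R) p = countLE R p := by
                rw [countLE, Finset.filter_insert, if_neg (by omega), countLE]
              rw [this]
              exact h2 p h
            · rw [countLE_of_forall_lt hmem (by omega), Finset.card_insert_of_notMem hnR]
              omega
          · simp only
            rw [Finset.card_insert_of_notMem hnR]
            omega

instance finite_stdTableau (n : ℕ) (μ : YoungDiagram) : Finite (StdTableau n μ) :=
  Finite.of_injective StdTableau.entry fun _ _ => StdTableau.eq_of_entry

instance fintype_eigIndex (n : ℕ) : Fintype (EigIndex n) := Fintype.ofFinite _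

/-- Only this inequality is needed, as linear independence supplies the opposite one. -/
lemma two_pow_le_card_eigIndex (n : ℕ) : 2 ^ n ≤ Fintype.card (EigIndex n) := by
  obtain ⟨T, hT, hprop⟩ := exists_ballot_family n
  have h1 : ∀ t : T, ∃ a : EigIndex n, lowerSet a.2.1 = t.1.1 ∧ (a.2.2 : ℕ) = t.1.2 := by
    rintro ⟨⟨R, l⟩, ht⟩
    obtain ⟨h1, h2, h3⟩ := hprop _ ht
    simp only at h1 h2 h3
    obtain ⟨Q, hQ⟩ := exists_lowerSet_eq h1 h2 (by omega)
    exact ⟨⟨⟨R.card, by omega⟩, Q, ⟨l, by simp only; omega⟩⟩, hQ, rfl⟩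
  choose f hf using h1
  rw [← hT, ← Fintype.card_coe]
  refine Fintype.card_le_of_injective f fun t t' h => ?_
  have h2 := hf t
  rw [h, (hf t').1, (hf t').2] at h2
  exact Subtype.ext (Prod.ext h2.1.symm h2.2.symm)

/-! ### Orthogonality and norms -/

lemma fQ_content {n m : ℕ} {hm : 2 * m ≤ n} (Q : StdTableau n (twoRow n m hm)) (l : ℕ) :
    HasContent (contentOf (lowerSet Q)) (fQ Q l) ∧
    innerPi (fQ Q l) (fQ Q l) = (gammaQ Q : ℂ) * innerPi (fT hm l) (fT hm l) :=
  -- The statements agree by unfolding, since `secondRow Q r` is `lowerRow Q r + 1`.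
  content_tau_prod (strictMono_lowerRow Q) (lowerRow_lt Q) (two_mul_add_one_le_lowerRow Q)
    (hasContent_fT hm l)

lemma gammaQ_ne_zero {n m : ℕ} {hm : 2 * m ≤ n} (Q : StdTableau n (twoRow n m hm)) :
    gammaQ Q ≠ 0 := by
  refine Finset.prod_ne_zero_iff.2 fun r _ => Finset.prod_ne_zero_iff.2 fun k hk => ?_
  have hk' : (2 : ℝ) ≤ k := by exact_mod_cast (Finset.mem_Icc.1 hk).1
  have : (0 : ℝ) < (k : ℝ) ^ 2 - 1 := by nlinarith
  positivity

lemma innerPi_fQ_self_ne_zero {n m : ℕ} {hm : 2 * m ≤ n} (Q : StdTableau n (twoRow n m hm))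
    {l : ℕ} (hl : l ≤ n - 2 * m) : innerPi (fQ Q l) (fQ Q l) ≠ 0 := by
  rw [(fQ_content Q l).2]
  exact mul_ne_zero (by exact_mod_cast gammaQ_ne_zero Q) (fT_ne_zero hm hl)

/-- Different second rows have different contents at some place, where a Jucys-Murphy operator
separates the vectors. Equal second rows force equal m and Q, and `separatingOp` separates the
degrees. -/
lemma innerPi_eigVec_of_ne {n : ℕ} {a b : EigIndex n} (hab : a ≠ b) :
    innerPi (eigVec a) (eigVec b) = 0 := by
  obtain ⟨m, Q, l⟩ := a
  obtain ⟨m', Q', l'⟩ := b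
  by_cases hR : lowerSet Q = lowerSet Q'
  · have hm : m = m' := Fin.ext (by rw [← card_lowerSet Q, hR, card_lowerSet])
    subst hm
    have hQ := eq_of_lowerSet_eq hR
    subst hQ
    refine innerPi_fQ_of_ne Q fun h => hab ?_
    have hl : l = l' := Fin.ext h
    rw [hl]
  · have h : ∃ p < n, contentOf (lowerSet Q) p ≠ contentOf (lowerSet Q') p := by
      by_contra! h
      exact hR (eq_of_contentOf_eq (ballot_lowerSet Q) (ballot_lowerSet Q')
        (fun _ => lt_of_mem_lowerSet Q) (fun _ => lt_of_mem_lowerSet Q') h)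
    obtain ⟨p, hp, hne⟩ := h
    exact (fQ_content Q l).1.orthogonal (fQ_content Q' l').1 hp hne

lemma linearIndependent_eigVec (n : ℕ) : LinearIndependent ℂ (eigVec (n := n)) := by
  rw [Fintype.linearIndependent_iff]
  intro g hg a
  have h1 : innerPi (∑ b, g b • eigVec b) (eigVec a) = g a * innerPi (eigVec a) (eigVec a) := by
    have h2 : ∀ s : Finset (EigIndex n), innerPi (∑ b ∈ s, g b • eigVec b) (eigVec a)
        = ∑ b ∈ s, g b * innerPi (eigVec b) (eigVec a) := by
      classical
      intro s
      induction s using Finset.induction_on with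
      | empty => simp [innerPi_zero_left]
      | insert b s hb ih =>
        rw [Finset.sum_insert hb, Finset.sum_insert hb, innerPi_add_left, innerPi_smul_left, ih]
    rw [h2]
    refine Finset.sum_eq_single a (fun b _ hb => ?_) (by simp)
    rw [innerPi_eigVec_of_ne hb, mul_zero]
  rw [hg, innerPi_zero_left] at h1
  refine (mul_eq_zero.1 h1.symm).resolve_right (innerPi_fQ_self_ne_zero _ ?_)
  exact Nat.lt_succ_iff.1 a.2.2.2

lemma span_eigVec (n : ℕ) : Submodule.span ℂ (Set.range (eigVec (n := n))) = ⊤ := by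
  have h1 : Module.finrank ℂ (TensorSpace n) = 2 ^ n := by
    rw [Module.finrank_fintype_fun_eq_card]
    simp
  refine (linearIndependent_eigVec n).span_eq_top_of_card_eq_finrank' ?_
  refine le_antisymm (linearIndependent_eigVec n).fintype_card_le_finrank ?_
  rw [h1]
  exact two_pow_le_card_eigIndex n

end

end BurnsideTableaux

theorem theorem2p2 (n : ℕ) :
    -- The inverses occurring in the intertwiners exist.
    (∀ a b : Fin n, (a : ℕ) + 1 = b → IsUnit (jucysMurphy a - jucysMurphy b)) ∧
    -- The vectors form an orthogonal basis.
    LinearIndependent ℂ (eigVec (n := n)) ∧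
    Submodule.span ℂ (Set.range (eigVec (n := n))) = ⊤ ∧
    (∀ a b : EigIndex n, a ≠ b → innerPi (eigVec a) (eigVec b) = 0) ∧
    -- They are eigenvectors of the transition operator.
    (∀ (m l : ℕ) (hm : 2 * m ≤ n) (Q : StdTableau n (twoRow n m hm)), l ≤ n - 2 * m →
      (transition n).HasEigenvector
        (if Even (m + l) then (beta ((m + l) / 2) : ℂ) else 0) (fQ Q l)) ∧
    -- Their squared norms.
    (∀ (m l : ℕ) (hm : 2 * m ≤ n) (Q : StdTableau n (twoRow n m hm)), l ≤ n - 2 * m →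
      innerPi (fQ Q l) (fQ Q l) = (gammaQ Q : ℂ) * innerPi (fT hm l) (fT hm l) ∧
      innerPi (fQ Q l) (fQ Q l) =
        ((gammaQ Q * (2 ^ m / ((n : ℝ) + 1)) *
          ∑ i ∈ Finset.range (n - 2 * m + 1),
            scalarT n m l i ^ 2 * ((n - 2 * m).choose i : ℝ) / (n.choose (m + i) : ℝ) : ℝ) : ℂ)) := by
  refine ⟨fun a b hab => isUnit_jmDiff hab, linearIndependent_eigVec n, span_eigVec n,
    fun a b hab => innerPi_eigVec_of_ne hab, fun m l hm Q hl => ?_, fun m l hm Q hl => ?_⟩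
  · refine Module.End.hasEigenvector_iff.2 ⟨Module.End.mem_eigenspace_iff.2 (transition_fQ Q l), ?_⟩
    intro h0
    apply innerPi_fQ_self_ne_zero Q hl
    rw [h0, innerPi_zero_left]
  · refine ⟨(fQ_content Q l).2, ?_⟩
    rw [(fQ_content Q l).2, innerPi_fT, ← Complex.ofReal_mul, mul_assoc]
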